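/- Let $n\geqslant 3$. Let $A_{A_n}$ be the Artin--Tits group of type $A_n$ (the braid group on $n+1$ strands), with standard generators $\sigma_1,\ldots,\sigma_n$, where $\sigma_i\sigma_{i+1}\sigma_i=\sigma_{i+1}\sigma_i\sigma_{i+1}$ and $\sigma_i\sigma_j=\sigma_j\sigma_i$ for $|i-j|\geqslant 2$. Let $A_{B_n}$ be the Artin--Tits group of type $B_n$, with standard generators $\tau_1,\ldots,\tau_n$, where $\tau_1\tau_2\tau_1\tau_2=\tau_2\tau_1\tau_2\tau_1$, $\tau_i\tau_{i+1}\tau_i=\tau_{i+1}\tau_i\tau_{i+1}$ for $2\leqslant i<n$, and $\tau_i\tau_j=\tau_j\tau_i$ for $|i-j|\geqslant 2$. Let $\Delta_{A_n}=(\sigma_1\cdots\sigma_n)(\sigma_1\cdots\sigma_{n-1})\cdots(\sigma_1\sigma_2)\sigma_1$ and $\Delta_{B_n}=(\tau_1\cdots\tau_n)^n$ be their Garside elements. For $A\in\{A_{A_n},A_{B_n}\}$ with Garside element $\Delta$, let $\mathcal P(A)$ be the union of the cyclic subgroup $\langle\Delta^2\rangle$ and of all proper irreducible standard parabolic subgroups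 of $A$, i.e. the subgroups generated by a nonempty proper subset of the standard generators that spans a connected subgraph of the Coxeter graph. Let $\eta:A_{B_n}\to A_{A_n}$ be the homomorphism with $\eta(\tau_1)=\sigma_1^2$ and $\eta(\tau_i)=\sigma_i$ for $i\geqslant 2$. Then $\mathcal P(A_{B_n})$ and $\mathcal P(A_{A_n})$ generate $A_{B_n}$ and $A_{A_n}$ respectively, $\eta$ is injective, and $\eta$ is a quasi-isometry from $A_{B_n}$ with the word metric $d_{\mathcal P(A_{B_n})}$ to $A_{A_n}$ with the word metric $d_{\mathcal P(A_{A_n})}$, where the word metric is $d_{\mathcal P}(x,y)=\|x^{-1}y\|_{\mathcal P}$, with $\|g\|_{\mathcal P}$ the least length of a word in $\mathcal P\cup\mathcal P^{-1}$ representing $g$. More precisely, $\eta$ is $1$-Lipschitz for these metrics. Put $a_0=1$ and $a_i=\sigma_i\cdots\sigma_1$ for $1\leqslant i\leqslant n$. For each $y\in A_{A_n}$ there is a unique $i\in\{0,\ldots,n\}$ with $ya_i\in\operatorname{Im}(\eta)$, and the map $\psi:A_{A_n}\to A_{B_n}$, $\psi(y)=\eta^{-1}(ya_i)$ for this $i$,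 is Lipschitz and satisfies $\psi(\eta(x))=x$ for all $x\in A_{B_n}$ and $d_{\mathcal P(A_{A_n})}(\eta(\psi(y)),y)\leqslant 2$ for all $y\in A_{A_n}$. -/

import Mathlib

/-! ### Artin-Tits groups -/

/-- The alternating product `Π(a, b; k) = a b a b ⋯` with `k` factors, starting with `a`. -/
def alternatingProd {G : Type*} [Monoid G] : G → G → ℕ → G
  | _, _, 0 => 1
  | a, b, k + 1 => a * alternatingProd b a k

namespace CoxeterMatrix

/-- The relations `Π(a, b; m_{a,b}) = Π(b, a; m_{a,b})` of the Artin-Tits group. As in the rest of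
Mathlib, the entry `0` stands for `∞`, and it then yields the trivial relation `1 = 1`; the
diagonal entries `1` yield the trivial relations `a = a`. -/
def artinRelations {S : Type*} (M : CoxeterMatrix S) : Set (FreeGroup S) :=
  {r | ∃ a b : S, r = alternatingProd (FreeGroup.of a) (FreeGroup.of b) (M a b) *
    (alternatingProd (FreeGroup.of b) (FreeGroup.of a) (M a b))⁻¹}

/-- The Artin-Tits group defined by a Coxeter matrix. -/
abbrev ArtinGroup {S : Type*} (M : CoxeterMatrix S) : Type _ :=
  PresentedGroup M.artinRelations

/-- The standard generators of the Artin-Tits group. -/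
def artinGen {S : Type*} (M : CoxeterMatrix S) (s : S) : M.ArtinGroup :=
  PresentedGroup.of s

/-- The Coxeter graph (without its labels): two distinct vertices are joined by an edge
unless they commute. -/
def coxeterGraph {S : Type*} (M : CoxeterMatrix S) : SimpleGraph S where
  Adj a b := a ≠ b ∧ M a b ≠ 2
  symm := ⟨fun a b h => ⟨h.1.symm, by rw [M.symmetric]; exact h.2⟩⟩
  loopless := ⟨fun _ h => h.1 rfl⟩

/-- The standard parabolic subgroup generated by the set `X` of standard generators. -/
def standardParabolic {S : Type*} (M : CoxeterMatrix S) (X : Set S) : Subgroup M.ArtinGroup :=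
  Subgroup.closure (M.artinGen '' X)

/-- `X` spans a proper irreducible standard parabolic subgroup: it is a nonempty proper
subset of the generators, and the induced subgraph of the Coxeter graph is connected. -/
def IsProperIrreducible {S : Type*} (M : CoxeterMatrix S) (X : Set S) : Prop :=
  X.Nonempty ∧ X ≠ Set.univ ∧ (M.coxeterGraph.induce X).Connected

/-- The set `𝒫(A)`: the union of all proper irreducible standard parabolic subgroups, together
with the cyclic subgroup generated by the square of the (Garside) element `Δ`. -/
def parabolicGenSet {S : Type*} (M : CoxeterMatrix S) (Δ : M.ArtinGroup) : Set M.ArtinGroup :=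
  {g | ∃ X : Set S, M.IsProperIrreducible X ∧ g ∈ M.standardParabolic X} ∪
    (Subgroup.zpowers (Δ ^ 2) : Set M.ArtinGroup)

end CoxeterMatrix

/-! ### Types `A_n` and `B_n` -/

/-- The Coxeter matrix of type `B_n`, numbered so that the edge labelled `4` joins the first two
vertices (Mathlib's numbering puts that edge at the other end). -/
def coxeterB (n : ℕ) : CoxeterMatrix (Fin n) :=
  (CoxeterMatrix.B n).reindex Fin.revPerm

theorem coxeterB_apply (n : ℕ) (i j : Fin n) :
    coxeterB n i j = if i = j then 1
      else if ((i : ℕ) = 0 ∧ (j : ℕ) = 1) ∨ ((j : ℕ) = 0 ∧ (i : ℕ) = 1) then 4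
      else if (j : ℕ) + 1 = i ∨ (i : ℕ) + 1 = j then 3 else 2 := by
  have hi := i.isLt
  have hj := j.isLt
  simp only [coxeterB, CoxeterMatrix.reindex_apply, CoxeterMatrix.B, Matrix.of_apply,
    Fin.revPerm_symm, Fin.revPerm_apply, Fin.rev_inj, Fin.val_rev]
  by_cases h : i = j
  · simp [h]
  · have h' : (i : ℕ) ≠ j := fun e => h (Fin.ext e)
    simp only [h, if_false]
    congr 1
    · apply propext; omega
    · congr 1
      apply propext; omega

/-- The Artin-Tits group of type `A_n`, that is, the braid group on `n + 1` strands. -/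
abbrev ArtinA (n : ℕ) : Type := (CoxeterMatrix.A n).ArtinGroup

/-- The Artin-Tits group of type `B_n`. -/
abbrev ArtinB (n : ℕ) : Type := (coxeterB n).ArtinGroup

/-- The standard generators of `ArtinA n`; `sigma n i` is `σ_{i+1}`. -/
def sigma (n : ℕ) (i : Fin n) : ArtinA n := (CoxeterMatrix.A n).artinGen i

/-- The standard generators of `ArtinB n`; `tau n i` is `τ_{i+1}`. -/
def tau (n : ℕ) (i : Fin n) : ArtinB n := (coxeterB n).artinGen i

/-- The Garside element (half twist) `(σ_1 ⋯ σ_n)(σ_1 ⋯ σ_{n-1}) ⋯ (σ_1 σ_2) σ_1`. -/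
def garsideA (n : ℕ) : ArtinA n :=
  ((List.range n).map fun j => (((List.finRange n).take (n - j)).map (sigma n)).prod).prod

/-- The Garside element `(τ_1 ⋯ τ_n) ^ n`. -/
def garsideB (n : ℕ) : ArtinB n :=
  (((List.finRange n).map (tau n)).prod) ^ n

/-- The set `𝒫(A_{A_n})`. -/
def genSetA (n : ℕ) : Set (ArtinA n) := (CoxeterMatrix.A n).parabolicGenSet (garsideA n)

/-- The set `𝒫(A_{B_n})`. -/
def genSetB (n : ℕ) : Set (ArtinB n) := (coxeterB n).parabolicGenSet (garsideB n)

/-- The braid `a_i = σ_i ⋯ σ_1`, with `a_0 = 1`. -/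
def braidArc (n i : ℕ) : ArtinA n :=
  (((List.finRange n).take i).reverse.map (sigma n)).prod

/-! ### The homomorphism `η` -/

theorem map_alternatingProd {G H F : Type*} [Monoid G] [Monoid H] [FunLike F G H]
    [MonoidHomClass F G H] (f : F) (k : ℕ) :
    ∀ a b : G, f (alternatingProd a b k) = alternatingProd (f a) (f b) k := by
  induction k with
  | zero => intro a b; simp [alternatingProd]
  | succ k ih => intro a b; simp [alternatingProd, ih]

theorem CoxeterMatrix.artinGen_relation {S : Type*} (M : CoxeterMatrix S) (a b : S) :
    alternatingProd (M.artinGen a) (M.artinGen b) (M a b) =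
      alternatingProd (M.artinGen b) (M.artinGen a) (M a b) := by
  have h := PresentedGroup.one_of_mem (rels := M.artinRelations) ⟨a, b, rfl⟩
  rw [map_mul, map_inv, mul_inv_eq_one, map_alternatingProd, map_alternatingProd] at h
  exact h

/-- The images of the generators under `η`: `τ_1 ↦ σ_1 ^ 2` and `τ_i ↦ σ_i` for `i ≥ 2`. -/
def etaGen (n : ℕ) (i : Fin n) : ArtinA n :=
  if (i : ℕ) = 0 then sigma n i ^ 2 else sigma n i

theorem sigma_comm {n : ℕ} {i j : Fin n} (h : (i : ℕ) + 1 < j) :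
    sigma n i * sigma n j = sigma n j * sigma n i := by
  have hr := (CoxeterMatrix.A n).artinGen_relation i j
  have hM : (CoxeterMatrix.A n) i j = 2 := by
    have h1 : i ≠ j := fun e => by subst e; omega
    have h2 : ¬ ((j : ℕ) + 1 = i ∨ (i : ℕ) + 1 = j) := by omega
    simp [CoxeterMatrix.A, h1, h2]
  rw [hM] at hr
  simpa [alternatingProd, sigma] using hr

theorem sigma_braid {n : ℕ} {i j : Fin n} (h : (i : ℕ) + 1 = j) :
    sigma n i * (sigma n j * sigma n i) = sigma n j * (sigma n i * sigma n j) := by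
  have hr := (CoxeterMatrix.A n).artinGen_relation i j
  have hM : (CoxeterMatrix.A n) i j = 3 := by
    have h1 : i ≠ j := fun e => by subst e; omega
    simp [CoxeterMatrix.A, h1, h]
  rw [hM] at hr
  simpa [alternatingProd, sigma] using hr

theorem etaGen_relation_of_lt {n : ℕ} {i j : Fin n} (h : i < j) :
    alternatingProd (etaGen n i) (etaGen n j) (coxeterB n i j) =
      alternatingProd (etaGen n j) (etaGen n i) (coxeterB n i j) := by
  have hv : (i : ℕ) < j := h
  have hne : i ≠ j := h.ne
  have hj0 : (j : ℕ) ≠ 0 := by omega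
  rw [coxeterB_apply, if_neg hne]
  by_cases hij : (i : ℕ) + 1 = j
  · by_cases hi0 : (i : ℕ) = 0
    · have hb := sigma_braid hij
      rw [if_pos (Or.inl ⟨hi0, by omega⟩)]
      simp only [alternatingProd, etaGen, hi0, hj0, if_true, if_false, mul_one]
      generalize sigma n i = a at *
      generalize sigma n j = b at *
      -- both sides are equal to `b * a * a * b * a * a`
      calc a ^ 2 * (b * (a ^ 2 * b)) = a * (a * (b * a)) * (a * b) := by simp only [pow_two, mul_assoc]
        _ = a * (b * (a * b)) * (a * b) := by rw [hb]
        _ = (a * (b * a)) * (b * (a * b)) := by simp only [mul_assoc]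
        _ = (b * (a * b)) * (a * (b * a)) := by rw [hb]
        _ = b * a * (b * (a * b)) * a := by simp only [mul_assoc]
        _ = b * a * (a * (b * a)) * a := by rw [hb]
        _ = b * (a ^ 2 * (b * a ^ 2)) := by simp only [pow_two, mul_assoc]
    · rw [if_neg (by omega), if_pos (Or.inr hij)]
      simpa only [alternatingProd, etaGen, hi0, hj0, if_false, mul_one] using sigma_braid hij
  · have hc : Commute (sigma n i) (sigma n j) := sigma_comm (by omega)
    rw [if_neg (by omega), if_neg (by omega)]
    simp only [alternatingProd, etaGen, hj0, if_false, mul_one]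
    split_ifs
    · exact (hc.pow_left 2).eq
    · exact hc.eq

theorem etaGen_relation (n : ℕ) (i j : Fin n) :
    alternatingProd (etaGen n i) (etaGen n j) (coxeterB n i j) =
      alternatingProd (etaGen n j) (etaGen n i) (coxeterB n i j) := by
  rcases lt_trichotomy i j with h | h | h
  · exact etaGen_relation_of_lt h
  · rw [h]
  · rw [(coxeterB n).symmetric]
    exact (etaGen_relation_of_lt h).symm

/-- The homomorphism `η : A_{B_n} → A_{A_n}` with `η(τ_1) = σ_1 ^ 2` and `η(τ_i) = σ_i` for
`i ≥ 2`. -/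
def eta (n : ℕ) : ArtinB n →* ArtinA n :=
  PresentedGroup.toGroup (f := etaGen n) (by
    rintro r ⟨i, j, rfl⟩
    rw [map_mul, map_inv, mul_inv_eq_one, map_alternatingProd, map_alternatingProd,
      FreeGroup.lift_apply_of, FreeGroup.lift_apply_of]
    exact etaGen_relation n i j)

theorem eta_tau (n : ℕ) (i : Fin n) :
    eta n (tau n i) = if (i : ℕ) = 0 then sigma n i ^ 2 else sigma n i :=
  PresentedGroup.toGroup.of _

/-! ### Word metrics and quasi-isometries -/

/-- The word norm: the least length of a word in `P ∪ P⁻¹` representing `g`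
(meaningful when `P` generates the group). -/
noncomputable def wordNorm {G : Type*} [Group G] (P : Set G) (g : G) : ℕ :=
  sInf {k | ∃ l : List G, l.length = k ∧ (∀ x ∈ l, x ∈ P ∨ x⁻¹ ∈ P) ∧ l.prod = g}

/-- The (left-invariant) word metric. -/
noncomputable def wordDist {G : Type*} [Group G] (P : Set G) (x y : G) : ℝ :=
  (wordNorm P (x⁻¹ * y) : ℝ)

/-- `f` is a quasi-isometry between `(X, dX)` and `(Y, dY)`: a quasi-isometric embedding whose
image is coarsely dense. -/
def IsQuasiIsometry {X Y : Type*} (dX : X → X → ℝ) (dY : Y → Y → ℝ) (f : X → Y) : Prop :=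
  ∃ K C : ℝ, 1 ≤ K ∧ 0 ≤ C ∧
    (∀ x x' : X, K⁻¹ * dX x x' - C ≤ dY (f x) (f x') ∧ dY (f x) (f x') ≤ K * dX x x' + C) ∧
    ∀ y : Y, ∃ x : X, dY (f x) y ≤ C

/-! Classically, `η` identifies the group of type `B_n` with the braids whose permutation fixes one
end point. This subgroup has index `n + 1`, with coset representatives `a_0, …, a_n`. The proof
obtains this algebraically, by running Reidemeister–Schreier backwards. Rewriting `σ_j a_i` as `a_k
η(c)` suggests an explicit cocycle `arcCocycle` with values in `ArtinB n`. Once the resulting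
permutations of the pairs `(i, b)` are known to satisfy the braid relations (`arcPerm_comm`,
`arcPerm_braid`), the braid group acts on these pairs. The map `(i, b) ↦ a_i η(b)` is equivariant
for `i ≤ n` (`arcAction_spec`), and the orbit of `(0, 1)` inverts it (`arcAction_arcBraid`).
Injectivity of `η`, existence and uniqueness of `i`, and the formula for `ψ` all follow.

The increment of `ψ` along a letter `s` is the inverse of the cocycle of `s⁻¹`
(`etaRetraction_mul`), so `ψ` is Lipschitz as soon as the cocycle has bounded norm on `𝒫`. A proper
connected `X` misses an end of the Coxeter graph. The cocycle on its parabolic subgroup then lies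
either in a proper irreducible parabolic subgroup of `ArtinB n` or in a fixed conjugate of one,
whence norm at most 3 (`wordNorm_arcAction_le_of_mem_standardParabolic`). On powers of the full
twist, the equality `η(Δ_B) = Δ_A ^ 2` and centrality give powers of `Δ_B`
(`arcAction_garsideA_zpow`). Together with `ψ ∘ η = id` and the bounded length of the `a_i`, this
makes `η` a quasi-isometry. -/

/-! ### Calculus in the braid monoid of a sequence satisfying the braid relations -/

section BraidSequence

variable {G : Type*} [Group G]

/-- The ascending product `s 0 * s 1 * ⋯ * s (k - 1)`. -/
def ascProd (s : ℕ → G) : ℕ → G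
  | 0 => 1
  | k + 1 => ascProd s k * s k

/-- The descending product `s (k - 1) * ⋯ * s 1 * s 0`. -/
def descProd (s : ℕ → G) : ℕ → G
  | 0 => 1
  | k + 1 => s k * descProd s k

/-- The half twist `ascProd s k * ascProd s (k - 1) * ⋯ * ascProd s 1`. -/
def halfTwist (s : ℕ → G) : ℕ → G
  | 0 => 1
  | k + 1 => ascProd s (k + 1) * halfTwist s k

/-- The sequence `s` satisfies the braid relations, the ones of length three being required only
for indices less than `n`. -/
structure IsBraidSeq (s : ℕ → G) (n : ℕ) : Prop where
  comm : ∀ i j, i + 1 < j → Commute (s i) (s j)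
  braid : ∀ i, i + 1 < n → s i * s (i + 1) * s i = s (i + 1) * s i * s (i + 1)

theorem ascProd_mem {s : ℕ → G} {H : Subgroup G} {k : ℕ} (h : ∀ i < k, s i ∈ H) :
    ascProd s k ∈ H := by
  induction k with
  | zero => exact H.one_mem
  | succ k ih => exact H.mul_mem (ih fun i hi => h i (by omega)) (h k (by omega))

theorem descProd_mem {s : ℕ → G} {H : Subgroup G} {k : ℕ} (h : ∀ i < k, s i ∈ H) :
    descProd s k ∈ H := by
  induction k with
  | zero => exact H.one_mem
  | succ k ih => exact H.mul_mem (h k (by omega)) (ih fun i hi => h i (by omega))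

theorem halfTwist_mem {s : ℕ → G} {H : Subgroup G} {k : ℕ} (h : ∀ i < k, s i ∈ H) :
    halfTwist s k ∈ H := by
  induction k with
  | zero => exact H.one_mem
  | succ k ih => exact H.mul_mem (ascProd_mem h) (ih fun i hi => h i (by omega))

namespace IsBraidSeq

variable {s : ℕ → G} {n : ℕ}

theorem commute_ascProd (hs : IsBraidSeq s n) {k j : ℕ} (h : k < j) :
    Commute (s j) (ascProd s k) := by
  induction k with
  | zero => exact Commute.one_right _
  | succ k ih => exact (ih (by omega)).mul_right (hs.comm k j h).symm

theorem commute_descProd (hs : IsBraidSeq s n) {k j : ℕ} (h : k < j) :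
    Commute (s j) (descProd s k) := by
  induction k with
  | zero => exact Commute.one_right _
  | succ k ih => exact (hs.comm k j h).symm.mul_right (ih (by omega))

theorem commute_halfTwist (hs : IsBraidSeq s n) {k j : ℕ} (h : k < j) :
    Commute (s j) (halfTwist s k) := by
  induction k with
  | zero => exact Commute.one_right _
  | succ k ih => exact (hs.commute_ascProd h).mul_right (ih (by omega))

theorem braid_left (hs : IsBraidSeq s n) {i : ℕ} (h : i + 1 < n) (x : G) :
    s i * (s (i + 1) * (s i * x)) = s (i + 1) * (s i * (s (i + 1) * x)) := by
  simp only [← mul_assoc, hs.braid i h]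

/-- The factors beyond `s (j + 1)` commute with `s j`, one braid relation turns `s j` into `s (j +
1)`, and the factors before `s j` commute with the result. This index shift drives all the full
twist computations below. -/
theorem ascProd_mul (hs : IsBraidSeq s n) {k j : ℕ} (hk : k ≤ n) (h : j + 1 < k) :
    ascProd s k * s j = s (j + 1) * ascProd s k := by
  induction k with
  | zero => omega
  | succ k ih =>
    obtain h' | rfl : j + 1 < k ∨ k = j + 1 := by omega
    · calc ascProd s k * s k * s j = ascProd s k * s j * s k := by
            rw [mul_assoc, mul_assoc, (hs.comm j k h').eq]
        _ = s (j + 1) * (ascProd s k * s k) := by rw [ih (by omega) h', mul_assoc]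
    · calc ascProd s j * s j * s (j + 1) * s j
          = ascProd s j * (s j * s (j + 1) * s j) := by simp only [mul_assoc]
        _ = ascProd s j * s (j + 1) * (s j * s (j + 1)) := by
            rw [hs.braid j (by omega)]; simp only [mul_assoc]
        _ = s (j + 1) * (ascProd s j * s j * s (j + 1)) := by
            rw [← (hs.commute_ascProd (Nat.lt_succ_self j)).eq]; simp only [mul_assoc]

theorem mul_descProd (hs : IsBraidSeq s n) {k j : ℕ} (hk : k ≤ n) (h : j + 1 < k) :
    s j * descProd s k = descProd s k * s (j + 1) := by
  induction k with
  | zero => omega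
  | succ k ih =>
    obtain h' | rfl : j + 1 < k ∨ k = j + 1 := by omega
    · calc s j * (s k * descProd s k) = s k * (s j * descProd s k) := by
            rw [← mul_assoc, ← mul_assoc, (hs.comm j k h').eq]
        _ = s k * descProd s k * s (j + 1) := by rw [ih (by omega) h', mul_assoc]
    · calc s j * (s (j + 1) * (s j * descProd s j))
          = s (j + 1) * s j * (s (j + 1) * descProd s j) := by
            rw [hs.braid_left (by omega)]; simp only [mul_assoc]
        _ = s (j + 1) * (s j * descProd s j) * s (j + 1) := by
            rw [(hs.commute_descProd (Nat.lt_succ_self j)).eq]; simp only [mul_assoc]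

theorem halfTwist_succ (hs : IsBraidSeq s n) (k : ℕ) :
    halfTwist s (k + 1) = halfTwist s k * descProd s (k + 1) := by
  induction k with
  | zero => simp [halfTwist, ascProd, descProd]
  | succ k ih =>
    calc ascProd s (k + 1) * s (k + 1) * halfTwist s (k + 1)
        = ascProd s (k + 1) * (s (k + 1) * halfTwist s k) * descProd s (k + 1) := by
          rw [ih]; simp only [mul_assoc]
      _ = ascProd s (k + 1) * halfTwist s k * (s (k + 1) * descProd s (k + 1)) := by
          rw [(hs.commute_halfTwist (Nat.lt_succ_self k)).eq]; simp only [mul_assoc]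

theorem ascProd_pow_mul (hs : IsBraidSeq s n) {k j : ℕ} (hk : k ≤ n) (h : j < k) :
    ascProd s k ^ j * s 0 = s j * ascProd s k ^ j := by
  induction j with
  | zero => simp
  | succ j ih =>
    rw [pow_succ', mul_assoc, ih (by omega), ← mul_assoc, hs.ascProd_mul hk h, mul_assoc]

/-- Moving every `s 0` to the left across powers of the ascending product raises its index, so the
letters collected are `s 0, s 1, …` in order. -/
theorem mul_ascProd_pow (hs : IsBraidSeq s n) {k j : ℕ} (hk : k ≤ n) (h : j ≤ k) :
    (s 0 * ascProd s k) ^ j = ascProd s j * ascProd s k ^ j := by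
  induction j with
  | zero => simp [ascProd]
  | succ j ih =>
    rw [pow_succ, ih (by omega), mul_assoc, ← mul_assoc (_ ^ j), hs.ascProd_pow_mul hk h,
      pow_succ, ascProd]
    simp only [mul_assoc]

theorem mul_ascProd_pow_self (hs : IsBraidSeq s n) {k : ℕ} (hk : k ≤ n) :
    (s 0 * ascProd s k) ^ k = ascProd s k ^ (k + 1) := by
  rw [hs.mul_ascProd_pow hk le_rfl, pow_succ']

/-- With `δ = ascProd s k`, the power `δ ^ (k + 1)` is also a power of `s 0 * δ`. It therefore
commutes with `s 0`, and hence with every conjugate of `s 0` by a power of `δ`. -/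
theorem commute_ascProd_pow (hs : IsBraidSeq s n) {k j : ℕ} (hk : k ≤ n) (h : j < k) :
    Commute (s j) (ascProd s k ^ (k + 1)) := by
  have h0 : Commute (s 0) (ascProd s k ^ (k + 1)) := by
    have h1 : Commute (s 0 * ascProd s k) (ascProd s k ^ (k + 1)) := by
      rw [← hs.mul_ascProd_pow_self hk]; exact Commute.self_pow _ _
    have h2 := h1.mul_left ((Commute.self_pow (ascProd s k) (k + 1)).inv_left)
    rwa [mul_inv_cancel_right] at h2
  have h3 : s j = ascProd s k ^ j * s 0 * (ascProd s k ^ j)⁻¹ := by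
    rw [hs.ascProd_pow_mul hk h, mul_inv_cancel_right]
  have h4 : Commute (ascProd s k ^ j) (ascProd s k ^ (k + 1)) := Commute.pow_pow_self _ _ _
  rw [h3]
  exact (h4.mul_left h0).mul_left h4.inv_left

theorem ascProd_succ_pow (hs : IsBraidSeq s n) {k : ℕ} (hk : k + 1 ≤ n) :
    ascProd s (k + 1) ^ (k + 1) = ascProd s k ^ (k + 1) * descProd s (k + 1) := by
  -- The factors of the power are peeled off one at a time: the last letter `s k` of the leading
  -- factor crosses the remaining `j` factors, becomes `s d` with `d = k - j`, and lengthens the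
  -- descending product.
  have key : ∀ j d : ℕ, j + d = k + 1 →
      ascProd s (k + 1) ^ j * descProd s d = ascProd s k ^ j * descProd s (k + 1) := by
    intro j
    induction j with
    | zero => intro d hd; obtain rfl : d = k + 1 := by omega
              simp
    | succ j ih =>
      intro d hd
      have h1 := ih (d + 1) (by omega)
      rcases Nat.eq_zero_or_pos j with rfl | hj
      · obtain rfl : d = k := by omega
        simp [ascProd, descProd, mul_assoc]
      have h2 : ∀ i, d ≤ i → i ≤ k → ascProd s (k + 1) ^ (i - d) * s d =
          s i * ascProd s (k + 1) ^ (i - d) := by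
        intro i hdi hik
        induction i, hdi using Nat.le_induction with
        | base => simp
        | succ i hdi ih' =>
          rw [Nat.succ_sub hdi, pow_succ', mul_assoc, ih' (by omega), ← mul_assoc,
            hs.ascProd_mul hk (by omega), mul_assoc]
      have h3 := h2 k (by omega) le_rfl
      rw [show k - d = j by omega] at h3
      calc ascProd s (k + 1) ^ (j + 1) * descProd s d
          = ascProd s k * (s k * ascProd s (k + 1) ^ j) * descProd s d := by
            rw [pow_succ', ascProd]; simp only [mul_assoc]
        _ = ascProd s k * (ascProd s (k + 1) ^ j * (s d * descProd s d)) := by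
            rw [← h3]; simp only [mul_assoc]
        _ = ascProd s k ^ (j + 1) * descProd s (k + 1) := by
            rw [pow_succ', mul_assoc, ← h1, descProd]
  simpa [descProd] using key (k + 1) 0 rfl

/-- The full twist is the square of the half twist. -/
theorem halfTwist_sq (hs : IsBraidSeq s n) {k : ℕ} (hk : k ≤ n) :
    halfTwist s k ^ 2 = ascProd s k ^ (k + 1) := by
  induction k with
  | zero => simp [halfTwist, ascProd]
  | succ k ih =>
    have h2 := ih (by omega)
    have hT : ascProd s (k + 1) ^ (k + 2) =
        ascProd s k ^ (k + 1) * (descProd s (k + 1) * ascProd s (k + 1)) := by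
      rw [pow_succ, hs.ascProd_succ_pow hk, mul_assoc]
    -- Crossing `descProd` raises the index of `s i` by one, and crossing `ascProd` lowers it again.
    have hJ : Commute (halfTwist s k) (descProd s (k + 1) * ascProd s (k + 1)) := by
      refine Subgroup.mem_centralizer_singleton_iff.1 (halfTwist_mem fun i hi => ?_)
      refine Subgroup.mem_centralizer_singleton_iff.2 ?_
      rw [← mul_assoc, hs.mul_descProd hk (by omega), mul_assoc,
        ← hs.ascProd_mul hk (by omega), mul_assoc]
    rw [hT, ← h2, pow_two, pow_two, mul_assoc, hJ.eq]
    nth_rewrite 1 [hs.halfTwist_succ]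
    rw [halfTwist]
    simp only [mul_assoc]

end IsBraidSeq

end BraidSequence
/-! ### The generators of the Artin-Tits groups as sequences -/

/-- The generators of `ArtinA n` as a sequence, extended by `1`. -/
def sigmaSeq (n i : ℕ) : ArtinA n := if h : i < n then sigma n ⟨i, h⟩ else 1

/-- The generators of `ArtinB n` as a sequence, extended by `1`. -/
def tauSeq (n i : ℕ) : ArtinB n := if h : i < n then tau n ⟨i, h⟩ else 1

theorem isBraidSeq_sigmaSeq (n : ℕ) : IsBraidSeq (sigmaSeq n) n where
  comm i j h := by
    unfold sigmaSeq
    split_ifs with h1 h2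
    · exact sigma_comm (by simpa using h)
    all_goals simp
  braid i h := by
    have h1 : i < n := by omega
    simp only [sigmaSeq, h, h1, dif_pos, mul_assoc]
    exact sigma_braid rfl

theorem tau_relation (n : ℕ) (i j : Fin n) :
    alternatingProd (tau n i) (tau n j) (coxeterB n i j) =
      alternatingProd (tau n j) (tau n i) (coxeterB n i j) :=
  (coxeterB n).artinGen_relation i j

theorem tauSeq_comm (n : ℕ) {i j : ℕ} (h : i + 1 < j) :
    Commute (tauSeq n i) (tauSeq n j) := by
  unfold tauSeq
  split_ifs with h1 h2
  · have hr := tau_relation n ⟨i, h1⟩ ⟨j, h2⟩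
    rw [coxeterB_apply, if_neg (by simp; omega), if_neg (by simp; omega),
      if_neg (by simp; omega)] at hr
    exact commute_iff_eq _ _ |>.2 (by simpa [alternatingProd, mul_assoc] using hr)
  all_goals simp

theorem tauSeq_braid (n : ℕ) {i : ℕ} (h0 : 1 ≤ i) (h : i + 1 < n) :
    tauSeq n i * tauSeq n (i + 1) * tauSeq n i =
      tauSeq n (i + 1) * tauSeq n i * tauSeq n (i + 1) := by
  have h1 : i < n := by omega
  have hr := tau_relation n ⟨i, h1⟩ ⟨i + 1, h⟩
  rw [coxeterB_apply, if_neg (by simp), if_neg (by simp; omega), if_pos (by simp)] at hr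
  simpa [tauSeq, h, h1, alternatingProd, mul_assoc] using hr

theorem tauSeq_braid_four (n : ℕ) (h : 1 < n) :
    tauSeq n 0 * tauSeq n 1 * tauSeq n 0 * tauSeq n 1 =
      tauSeq n 1 * tauSeq n 0 * tauSeq n 1 * tauSeq n 0 := by
  have h1 : 0 < n := by omega
  have hr := tau_relation n ⟨0, h1⟩ ⟨1, h⟩
  rw [coxeterB_apply, if_neg (by simp), if_pos (by simp)] at hr
  simpa [tauSeq, h, h1, alternatingProd, mul_assoc] using hr

theorem isBraidSeq_tauSeq_succ (n : ℕ) : IsBraidSeq (fun i => tauSeq n (i + 1)) (n - 1) where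
  comm i j h := tauSeq_comm n (by omega)
  braid i h := tauSeq_braid n (by omega) (by omega)

theorem eta_tauSeq_zero (n : ℕ) : eta n (tauSeq n 0) = sigmaSeq n 0 ^ 2 := by
  unfold tauSeq sigmaSeq
  split_ifs with h
  · rw [eta_tau, if_pos rfl]
  · simp

theorem eta_tauSeq_succ (n i : ℕ) : eta n (tauSeq n (i + 1)) = sigmaSeq n (i + 1) := by
  unfold tauSeq sigmaSeq
  split_ifs with h
  · rw [eta_tau, if_neg (by simp)]
  · simp

theorem eta_tauSeq_of_pos (n : ℕ) {i : ℕ} (h : 0 < i) :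
    eta n (tauSeq n i) = sigmaSeq n i := by
  obtain ⟨j, rfl⟩ : ∃ j, i = j + 1 := ⟨i - 1, by omega⟩
  exact eta_tauSeq_succ n j

theorem sigmaSeq_induction {n : ℕ} (H : Subgroup (ArtinA n)) (h : ∀ j < n, sigmaSeq n j ∈ H)
    (g : ArtinA n) : g ∈ H := by
  refine PresentedGroup.generated_by _ H (fun j => ?_) g
  have := h j j.2
  rwa [sigmaSeq, dif_pos j.2] at this

theorem tauSeq_induction {n : ℕ} (H : Subgroup (ArtinB n)) (h : ∀ j < n, tauSeq n j ∈ H)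
    (g : ArtinB n) : g ∈ H := by
  refine PresentedGroup.generated_by _ H (fun j => ?_) g
  have := h j j.2
  rwa [tauSeq, dif_pos j.2] at this

theorem take_finRange_succ {n k : ℕ} (h : k < n) :
    (List.finRange n).take (k + 1) = (List.finRange n).take k ++ [⟨k, h⟩] := by
  rw [List.take_add_one]
  simp [h]

theorem braidArc_eq_descProd {n k : ℕ} (h : k ≤ n) :
    braidArc n k = descProd (sigmaSeq n) k := by
  induction k with
  | zero => simp [braidArc, descProd]
  | succ k ih =>
    rw [descProd, ← ih (by omega), braidArc, take_finRange_succ h]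
    simp [braidArc, sigmaSeq, show k < n from h]

theorem prod_take_sigma {n k : ℕ} (h : k ≤ n) :
    (((List.finRange n).take k).map (sigma n)).prod = ascProd (sigmaSeq n) k := by
  induction k with
  | zero => simp [ascProd]
  | succ k ih =>
    rw [ascProd, ← ih (by omega), take_finRange_succ h]
    simp [sigmaSeq, show k < n from h]

theorem prod_take_tau {n k : ℕ} (h : k ≤ n) :
    (((List.finRange n).take k).map (tau n)).prod = ascProd (tauSeq n) k := by
  induction k with
  | zero => simp [ascProd]
  | succ k ih =>
    rw [ascProd, ← ih (by omega), take_finRange_succ h]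
    simp [tauSeq, show k < n from h]

theorem garsideA_eq_halfTwist (n : ℕ) : garsideA n = halfTwist (sigmaSeq n) n := by
  have key : ∀ k ≤ n, ((List.range k).map fun j =>
      (((List.finRange n).take (k - j)).map (sigma n)).prod).prod = halfTwist (sigmaSeq n) k := by
    intro k hk
    induction k with
    | zero => simp [halfTwist]
    | succ k ih =>
      rw [halfTwist, ← ih (by omega), ← prod_take_sigma hk, List.range_succ_eq_map]
      simp [List.map_map, Function.comp_def]
  exact key n le_rfl

/-- The product `τ_1 ⋯ τ_n` maps to `σ_1 (σ_1 ⋯ σ_n)`, whose `n`-th power is `(σ_1 ⋯ σ_n) ^ (n +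
1)`, the full twist. -/
theorem eta_garsideB (n : ℕ) : eta n (garsideB n) = garsideA n ^ 2 := by
  have hs := isBraidSeq_sigmaSeq n
  have h1 : ∀ k, 0 < k → eta n (ascProd (tauSeq n) k) = sigmaSeq n 0 * ascProd (sigmaSeq n) k := by
    intro k hk
    induction k, hk using Nat.le_induction with
    | base => simp [ascProd, eta_tauSeq_zero, pow_two]
    | succ k hk ih =>
      rw [ascProd, map_mul, ih, eta_tauSeq_of_pos n hk, mul_assoc, ascProd]
  have h2 := prod_take_tau (le_refl n)
  rw [List.take_of_length_le (by simp)] at h2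
  rw [garsideB, h2, map_pow, garsideA_eq_halfTwist, hs.halfTwist_sq le_rfl,
    ← hs.mul_ascProd_pow_self le_rfl]
  rcases Nat.eq_zero_or_pos n with h | h
  · subst h; simp
  · rw [h1 n h]

theorem commute_garsideA_sq (n : ℕ) (g : ArtinA n) : Commute g (garsideA n ^ 2) := by
  have hs := isBraidSeq_sigmaSeq n
  rw [garsideA_eq_halfTwist, hs.halfTwist_sq le_rfl]
  refine Subgroup.mem_centralizer_singleton_iff.1 (sigmaSeq_induction _ (fun j hj => ?_) g)
  exact Subgroup.mem_centralizer_singleton_iff.2 (hs.commute_ascProd_pow le_rfl hj)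

/-! ### The pure braids around the first strand -/

/-- The conjugates `m_j = (τ_j ⋯ τ_1) τ_0 (τ_j ⋯ τ_1)⁻¹` in `ArtinB n`. -/
def tauLoop (n : ℕ) : ℕ → ArtinB n
  | 0 => tauSeq n 0
  | j + 1 => tauSeq n (j + 1) * tauLoop n j * (tauSeq n (j + 1))⁻¹

theorem tauLoop_succ_mul (n j : ℕ) :
    tauLoop n (j + 1) * tauSeq n (j + 1) = tauSeq n (j + 1) * tauLoop n j := by
  rw [tauLoop, inv_mul_cancel_right]

theorem tauLoop_comm_of_lt (n : ℕ) {j k : ℕ} (h : j + 1 < k) :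
    Commute (tauSeq n k) (tauLoop n j) := by
  induction j with
  | zero => exact (tauSeq_comm n h).symm
  | succ j ih =>
    have h1 : Commute (tauSeq n k) (tauSeq n (j + 1)) := (tauSeq_comm n h).symm
    exact (h1.mul_right (ih (by omega))).mul_right h1.inv_right

/-- In the critical case `j = k + 1`, the loop is `m = tauLoop n (k - 1)` conjugated by `τ_{k+1}
τ_k`. That conjugation carries `τ_{k+1}`, which commutes with `m`, to `τ_k`. -/
theorem tauLoop_comm_of_gt {n j k : ℕ} (h0 : 0 < k) (h : k < j) (hn : j < n) :
    Commute (tauSeq n k) (tauLoop n j) := by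
  induction j with
  | zero => omega
  | succ j ih =>
    obtain h' | rfl : k < j ∨ j = k := by omega
    · have h1 : Commute (tauSeq n k) (tauSeq n (j + 1)) := tauSeq_comm n (by omega)
      exact (h1.mul_right (ih h' (by omega))).mul_right h1.inv_right
    · obtain ⟨i, rfl⟩ : ∃ i, j = i + 1 := ⟨j - 1, by omega⟩
      have hb := tauSeq_braid n h0 hn
      have hc := (tauLoop_comm_of_lt n (show i + 1 < i + 1 + 1 by omega)).eq
      rw [tauLoop, tauLoop]
      generalize tauSeq n (i + 1) = a at *
      generalize tauSeq n (i + 1 + 1) = b at *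
      generalize tauLoop n i = m at *
      have hb' : a⁻¹ * b⁻¹ * a = b * a⁻¹ * b⁻¹ := by
        calc a⁻¹ * b⁻¹ * a = a⁻¹ * b⁻¹ * (a * b * a) * a⁻¹ * b⁻¹ := by group
          _ = b * a⁻¹ * b⁻¹ := by rw [hb]; group
      show a * (b * (a * m * a⁻¹) * b⁻¹) = b * (a * m * a⁻¹) * b⁻¹ * a
      calc a * (b * (a * m * a⁻¹) * b⁻¹) = (a * b * a) * m * a⁻¹ * b⁻¹ := by
            simp only [mul_assoc]
        _ = b * a * (b * m) * a⁻¹ * b⁻¹ := by rw [hb]; simp only [mul_assoc]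
        _ = b * a * m * (b * a⁻¹ * b⁻¹) := by rw [hc]; simp only [mul_assoc]
        _ = b * (a * m * a⁻¹) * b⁻¹ * a := by rw [← hb']; simp only [mul_assoc]

theorem tauLoop_braid_four {n j : ℕ} (h : j + 1 < n) :
    tauLoop n j * tauSeq n (j + 1) * tauLoop n j * tauSeq n (j + 1) =
      tauSeq n (j + 1) * tauLoop n j * tauSeq n (j + 1) * tauLoop n j := by
  induction j with
  | zero => exact tauSeq_braid_four n h
  | succ j ih =>
    have ih := ih (by omega)
    have hb := tauSeq_braid n (show 1 ≤ j + 1 by omega) h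
    have hc := (tauLoop_comm_of_lt n (show j + 1 < j + 1 + 1 by omega)).eq
    rw [tauLoop]
    generalize tauSeq n (j + 1) = a at *
    generalize tauSeq n (j + 1 + 1) = b at *
    generalize tauLoop n j = m at *
    -- Conjugation by `a * b` carries the pair `(m, a)` to the next pair, so the relation of length
    -- four is transported from `j` to `j + 1`.
    have e1 : MulAut.conj (a * b) m = a * m * a⁻¹ := by
      rw [MulAut.conj_apply, mul_assoc a b, hc]; group
    have e2 : MulAut.conj (a * b) a = b := by
      rw [MulAut.conj_apply, hb]; group
    generalize MulAut.conj (a * b) = φ at e1 e2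
    have e3 := congrArg φ ih
    simpa only [map_mul, e1, e2] using e3

theorem tauLoop_mul_tauLoop_succ {n j : ℕ} (h : j + 1 < n) :
    tauLoop n j * (tauLoop n (j + 1) * tauSeq n (j + 1)) =
      tauSeq n (j + 1) * (tauLoop n j * tauLoop n (j + 1)) := by
  have h4 := tauLoop_braid_four h
  rw [tauLoop_succ_mul, tauLoop, ← mul_assoc, ← mul_assoc, ← mul_assoc, eq_mul_inv_iff_mul_eq]
  simpa only [mul_assoc] using h4
/-! ### The action of the braid group on the cosets of the image of `η` -/

/-- The cocycle: `σ_j a_i = a_k η(arcCocycle n j i)`, where `k` is the image of `i` under the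
transposition `(j, j + 1)`. -/
def arcCocycle (n j i : ℕ) : ArtinB n :=
  if i < j then tauSeq n j else if i = j then 1 else if i = j + 1 then tauLoop n j
  -- Indices above `n` represent no braid; the value `1` makes each `σ_j` fix those points, so that
  -- the relations hold there too.
  else if i ≤ n then tauSeq n (j + 1) else 1

theorem arcCocycle_of_lt {n j i : ℕ} (h : i < j) : arcCocycle n j i = tauSeq n j := if_pos h

theorem arcCocycle_self (n j : ℕ) : arcCocycle n j j = 1 := by simp [arcCocycle]

theorem arcCocycle_succ (n j : ℕ) : arcCocycle n j (j + 1) = tauLoop n j := by simp [arcCocycle]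

theorem arcCocycle_of_gt {n j i : ℕ} (h : j + 1 < i) (hi : i ≤ n) :
    arcCocycle n j i = tauSeq n (j + 1) := by
  rw [arcCocycle, if_neg (by omega), if_neg (by omega), if_neg (by omega), if_pos hi]

theorem arcCocycle_of_gt_of_gt {n j i : ℕ} (h : j + 1 < i) (hi : n < i) :
    arcCocycle n j i = 1 := by
  rw [arcCocycle, if_neg (by omega), if_neg (by omega), if_neg (by omega), if_neg (by omega)]

/-- The permutation of `ℕ × ArtinB n` by which `σ_j` acts; a pair `(i, b)` with `i ≤ n` stands
for the braid `a_i η(b)`. -/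
def arcPerm (n j : ℕ) : Equiv.Perm (ℕ × ArtinB n) :=
  Equiv.prodShear (Equiv.swap j (j + 1)) fun i => Equiv.mulLeft (arcCocycle n j i)

theorem arcPerm_apply (n j i : ℕ) (b : ArtinB n) :
    arcPerm n j (i, b) = (Equiv.swap j (j + 1) i, arcCocycle n j i * b) := rfl

theorem swap_succ_of_ne {j i : ℕ} (h : i ≠ j) (h' : i ≠ j + 1) :
    Equiv.swap j (j + 1) i = i := Equiv.swap_apply_of_ne_of_ne h h'

theorem arcPerm_of_lt {n j i : ℕ} (h : i < j) (b : ArtinB n) :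
    arcPerm n j (i, b) = (i, tauSeq n j * b) := by
  rw [arcPerm_apply, swap_succ_of_ne (by omega) (by omega), arcCocycle_of_lt h]

theorem arcPerm_self (n j : ℕ) (b : ArtinB n) : arcPerm n j (j, b) = (j + 1, b) := by
  rw [arcPerm_apply, Equiv.swap_apply_left, arcCocycle_self, one_mul]

theorem arcPerm_succ (n j : ℕ) (b : ArtinB n) :
    arcPerm n j (j + 1, b) = (j, tauLoop n j * b) := by
  rw [arcPerm_apply, Equiv.swap_apply_right, arcCocycle_succ]

theorem arcPerm_of_gt {n j i : ℕ} (h : j + 1 < i) (hi : i ≤ n) (b : ArtinB n) :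
    arcPerm n j (i, b) = (i, tauSeq n (j + 1) * b) := by
  rw [arcPerm_apply, swap_succ_of_ne (by omega) (by omega), arcCocycle_of_gt h hi]

theorem arcPerm_of_gt_of_gt {n j i : ℕ} (h : j + 1 < i) (hi : n < i) (b : ArtinB n) :
    arcPerm n j (i, b) = (i, b) := by
  rw [arcPerm_apply, swap_succ_of_ne (by omega) (by omega), arcCocycle_of_gt_of_gt h hi, one_mul]

theorem arcPerm_comm {n j k : ℕ} (h : j + 1 < k) (hk : k < n) :
    arcPerm n j * arcPerm n k = arcPerm n k * arcPerm n j := by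
  ext1 ⟨i, b⟩
  simp only [Equiv.Perm.mul_apply]
  rcases lt_or_ge n i with hn | hn
  · rw [arcPerm_of_gt_of_gt (show k + 1 < i by omega) hn,
      arcPerm_of_gt_of_gt (show j + 1 < i by omega) hn,
      arcPerm_of_gt_of_gt (show k + 1 < i by omega) hn]
  obtain hi | rfl | rfl | ⟨hi, hi'⟩ | rfl | rfl | hi : i < j ∨ i = j ∨ i = j + 1 ∨
      (j + 1 < i ∧ i < k) ∨ i = k ∨ i = k + 1 ∨ k + 1 < i := by omega
  · have hc := tauSeq_comm n h
    rw [arcPerm_of_lt hi, arcPerm_of_lt (show i < k by omega), arcPerm_of_lt hi,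
      arcPerm_of_lt (show i < k by omega), ← mul_assoc, ← mul_assoc, hc.eq]
  · rw [arcPerm_of_lt (show i < k by omega), arcPerm_self, arcPerm_self, arcPerm_of_lt h]
  · rw [arcPerm_of_lt h, arcPerm_succ, arcPerm_succ, arcPerm_of_lt (show j < k by omega),
      ← mul_assoc, ← mul_assoc, (tauLoop_comm_of_lt n h).eq]
  · have hc := tauSeq_comm n (show j + 1 + 1 < k by omega)
    rw [arcPerm_of_lt hi', arcPerm_of_gt hi hn, arcPerm_of_gt hi hn, arcPerm_of_lt hi',
      ← mul_assoc, ← mul_assoc, hc.eq]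
  · rw [arcPerm_self, arcPerm_of_gt (by omega) hn, arcPerm_of_gt (by omega) (by omega),
      arcPerm_self]
  · rw [arcPerm_succ, arcPerm_of_gt h (by omega), arcPerm_of_gt (by omega) hn, arcPerm_succ,
      ← mul_assoc, ← mul_assoc, (tauLoop_comm_of_gt (Nat.succ_pos j) h hk).eq]
  · have hc := tauSeq_comm n (show j + 1 + 1 < k + 1 by omega)
    rw [arcPerm_of_gt (by omega) hn, arcPerm_of_gt (by omega) hn, arcPerm_of_gt (by omega) hn,
      arcPerm_of_gt (by omega) hn, ← mul_assoc, ← mul_assoc, hc.eq]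

theorem tauSeq_braid_left {n i : ℕ} (h0 : 1 ≤ i) (h : i + 1 < n) (b : ArtinB n) :
    tauSeq n i * (tauSeq n (i + 1) * (tauSeq n i * b)) =
      tauSeq n (i + 1) * (tauSeq n i * (tauSeq n (i + 1) * b)) := by
  simp only [← mul_assoc, tauSeq_braid n h0 h]

/-- For `i < j` or `i > j + 2` this is a relation of length three between `τ`s of positive index.
Among the three moved positions, `i = j` is immediate, `i = j + 1` is the recursion for `tauLoop`,
and `i = j + 2` is where the relation of length four enters. -/
theorem arcPerm_braid {n j : ℕ} (h : j + 1 < n) :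
    arcPerm n j * (arcPerm n (j + 1) * arcPerm n j) =
      arcPerm n (j + 1) * (arcPerm n j * arcPerm n (j + 1)) := by
  ext1 ⟨i, b⟩
  simp only [Equiv.Perm.mul_apply]
  rcases lt_or_ge n i with hn | hn
  · simp only [arcPerm_of_gt_of_gt (show j + 1 < i by omega) hn,
      arcPerm_of_gt_of_gt (show j + 1 + 1 < i by omega) hn]
  obtain hi | rfl | rfl | rfl | hi : i < j ∨ i = j ∨ i = j + 1 ∨ i = j + 1 + 1 ∨
      j + 1 + 1 < i := by omega
  · simp only [arcPerm_of_lt hi, arcPerm_of_lt (show i < j + 1 by omega),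
      tauSeq_braid_left (show 1 ≤ j by omega) h]
  · simp only [arcPerm_self, arcPerm_of_lt (Nat.lt_succ_self i),
      arcPerm_of_gt (Nat.lt_succ_self (i + 1)) (show i + 1 + 1 ≤ n by omega)]
  · simp only [arcPerm_self, arcPerm_succ, arcPerm_of_lt (Nat.lt_succ_self j),
      arcPerm_of_gt (Nat.lt_succ_self (j + 1)) (show j + 1 + 1 ≤ n by omega)]
    rw [← mul_assoc, ← mul_assoc, tauLoop_succ_mul]
  · simp only [arcPerm_succ, arcPerm_of_lt (Nat.lt_succ_self j),
      arcPerm_of_gt (Nat.lt_succ_self (j + 1)) (show j + 1 + 1 ≤ n by omega)]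
    have e := congrArg (· * b) (tauLoop_mul_tauLoop_succ h)
    simpa only [mul_assoc] using congrArg (Prod.mk j) e
  · simp only [arcPerm_of_gt (show j + 1 < i by omega) hn, arcPerm_of_gt hi hn,
      tauSeq_braid_left (show 1 ≤ j + 1 by omega) (show j + 1 + 1 < n by omega)]

theorem arcPerm_relation_of_lt {n : ℕ} {i j : Fin n} (h : i < j) :
    alternatingProd (arcPerm n i) (arcPerm n j) (CoxeterMatrix.A n i j) =
      alternatingProd (arcPerm n j) (arcPerm n i) (CoxeterMatrix.A n i j) := by
  have hv : (i : ℕ) < j := h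
  by_cases hij : (i : ℕ) + 1 = j
  · have hM : CoxeterMatrix.A n i j = 3 := by simp [CoxeterMatrix.A, h.ne, hij]
    have hj : (j : ℕ) < n := j.2
    rw [hM, ← hij]
    simpa only [alternatingProd, mul_one] using arcPerm_braid (by omega)
  · have h2 : ¬ ((j : ℕ) + 1 = i ∨ (i : ℕ) + 1 = j) := by omega
    have hM : CoxeterMatrix.A n i j = 2 := by simp [CoxeterMatrix.A, h.ne, h2]
    rw [hM]
    simpa only [alternatingProd, mul_one] using arcPerm_comm (by omega) j.2

theorem arcPerm_relation (n : ℕ) (i j : Fin n) :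
    alternatingProd (arcPerm n i) (arcPerm n j) (CoxeterMatrix.A n i j) =
      alternatingProd (arcPerm n j) (arcPerm n i) (CoxeterMatrix.A n i j) := by
  rcases lt_trichotomy i j with h | h | h
  · exact arcPerm_relation_of_lt h
  · rw [h]
  · rw [(CoxeterMatrix.A n).symmetric]
    exact (arcPerm_relation_of_lt h).symm

/-- The action of the braid group on `ℕ × ArtinB n`. -/
def arcAction (n : ℕ) : ArtinA n →* Equiv.Perm (ℕ × ArtinB n) :=
  PresentedGroup.toGroup (f := fun i : Fin n => arcPerm n i) (by
    rintro r ⟨i, j, rfl⟩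
    rw [map_mul, map_inv, mul_inv_eq_one, map_alternatingProd, map_alternatingProd,
      FreeGroup.lift_apply_of, FreeGroup.lift_apply_of]
    exact arcPerm_relation n i j)

/-! ### Coset representatives, injectivity of `η` and the retraction -/

theorem arcAction_sigmaSeq {n j : ℕ} (h : j < n) : arcAction n (sigmaSeq n j) = arcPerm n j := by
  rw [sigmaSeq, dif_pos h]
  exact PresentedGroup.toGroup.of _

/-- The braid `a_i η(b)` represented by the pair `(i, b)`. -/
def arcBraid (n : ℕ) (p : ℕ × ArtinB n) : ArtinA n := descProd (sigmaSeq n) p.1 * eta n p.2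

theorem descProd_mul_eta_tauLoop {n j : ℕ} (h : j < n) :
    descProd (sigmaSeq n) j * eta n (tauLoop n j) =
      sigmaSeq n j * (sigmaSeq n j * descProd (sigmaSeq n) j) := by
  have hs := isBraidSeq_sigmaSeq n
  induction j with
  | zero => simp [descProd, tauLoop, eta_tauSeq_zero, pow_two]
  | succ j ih =>
    have ih := ih (by omega)
    have hc := (hs.commute_descProd (Nat.lt_succ_self j)).eq
    rw [tauLoop, map_mul, map_mul, map_inv, eta_tauSeq_succ, descProd, ← mul_assoc, ← mul_assoc,
      mul_inv_eq_iff_eq_mul]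
    have hb := hs.braid j h
    have hl := hs.braid_left h
    generalize sigmaSeq n (j + 1) = b at *
    generalize sigmaSeq n j = a at *
    generalize descProd (sigmaSeq n) j = d at *
    calc a * d * b * eta n (tauLoop n j) = a * (b * d) * eta n (tauLoop n j) := by
          rw [hc]; simp only [mul_assoc]
      _ = a * (b * (a * (a * d))) := by rw [← ih]; simp only [mul_assoc]
      _ = b * (b * (a * (b * d))) := by rw [hl, hl]
      _ = b * (b * (a * d)) * b := by rw [hc]; simp only [mul_assoc]

theorem arcBraid_arcPerm {n j : ℕ} (hj : j < n) {p : ℕ × ArtinB n} (hp : p.1 ≤ n) :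
    arcBraid n (arcPerm n j p) = sigmaSeq n j * arcBraid n p := by
  have hs := isBraidSeq_sigmaSeq n
  obtain ⟨i, b⟩ := p
  obtain hi | rfl | rfl | hi : i < j ∨ i = j ∨ i = j + 1 ∨ j + 1 < i := by omega
  · rw [arcPerm_of_lt hi, arcBraid, arcBraid, map_mul, eta_tauSeq_of_pos n (by omega),
      ← mul_assoc, ← mul_assoc, (hs.commute_descProd hi).eq]
  · rw [arcPerm_self, arcBraid, arcBraid, descProd, mul_assoc]
  · rw [arcPerm_succ, arcBraid, arcBraid, map_mul, ← mul_assoc, descProd_mul_eta_tauLoop hj,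
      descProd]
    simp only [mul_assoc]
  · rw [arcPerm_of_gt hi hp, arcBraid, arcBraid, map_mul, eta_tauSeq_succ, ← mul_assoc,
      ← mul_assoc, hs.mul_descProd hp hi]

theorem arcPerm_fst_le_iff {n j : ℕ} (hj : j < n) (p : ℕ × ArtinB n) :
    (arcPerm n j p).1 ≤ n ↔ p.1 ≤ n := by
  obtain ⟨i, b⟩ := p
  rw [arcPerm_apply, Equiv.swap_apply_def]
  split_ifs <;> simp only <;> omega

theorem arcAction_spec {n : ℕ} (g : ArtinA n) (p : ℕ × ArtinB n) :
    ((arcAction n g p).1 ≤ n ↔ p.1 ≤ n) ∧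
      (p.1 ≤ n → arcBraid n (arcAction n g p) = g * arcBraid n p) := by
  -- The condition `i ≤ n` is carried along, because equivariance is only claimed there and must
  -- survive composition and inversion.
  let H : Subgroup (ArtinA n) :=
    { carrier := {g | ∀ p, ((arcAction n g p).1 ≤ n ↔ p.1 ≤ n) ∧
        (p.1 ≤ n → arcBraid n (arcAction n g p) = g * arcBraid n p)}
      one_mem' := fun p => by simp
      mul_mem' := fun {x y} hx hy p => by
        rw [map_mul, Equiv.Perm.mul_apply]
        refine ⟨(hx _).1.trans (hy p).1, fun hp => ?_⟩
        rw [(hx _).2 ((hy p).1.2 hp), (hy p).2 hp, mul_assoc]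
      inv_mem' := fun {x} hx p => by
        have h := hx (arcAction n x⁻¹ p)
        rw [map_inv, ← Equiv.Perm.mul_apply, mul_inv_cancel, Equiv.Perm.one_apply] at h
        rw [map_inv]
        refine ⟨h.1.symm, fun hp => ?_⟩
        rw [h.2 (h.1.1 hp), inv_mul_cancel_left] }
  refine sigmaSeq_induction H (fun j hj p => ?_) g p
  rw [arcAction_sigmaSeq hj]
  exact ⟨arcPerm_fst_le_iff hj p, arcBraid_arcPerm hj⟩

/-- Over the base index `0`, the image of `η` acts by left translation; in particular `x` can be
recovered from `η(x)`. -/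
theorem arcAction_eta {n : ℕ} (x b : ArtinB n) :
    arcAction n (eta n x) (0, b) = (0, x * b) := by
  let H : Subgroup (ArtinB n) :=
    { carrier := {x | ∀ b, arcAction n (eta n x) (0, b) = (0, x * b)}
      one_mem' := fun p => by simp
      mul_mem' := fun {x y} hx hy p => by
        rw [map_mul, map_mul, Equiv.Perm.mul_apply, hy, hx, mul_assoc]
      inv_mem' := fun {x} hx p => by
        rw [map_inv, map_inv, Equiv.Perm.inv_eq_iff_eq, hx, mul_inv_cancel_left] }
  refine tauSeq_induction H (fun j hj b => ?_) x b
  rcases Nat.eq_zero_or_pos j with rfl | hj0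
  · rw [eta_tauSeq_zero, map_pow, arcAction_sigmaSeq hj, pow_two, Equiv.Perm.mul_apply,
      arcPerm_self, arcPerm_succ, tauLoop]
  · rw [eta_tauSeq_of_pos n hj0, arcAction_sigmaSeq hj, arcPerm_of_lt hj0]

theorem arcAction_arcBraid {n : ℕ} {p : ℕ × ArtinB n} (hp : p.1 ≤ n) :
    arcAction n (arcBraid n p) (0, 1) = p := by
  obtain ⟨i, b⟩ := p
  rw [arcBraid, map_mul, Equiv.Perm.mul_apply, arcAction_eta, mul_one]
  have hp : i ≤ n := hp
  induction i with
  | zero => simp [descProd]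
  | succ i ih =>
    rw [descProd, map_mul, Equiv.Perm.mul_apply, ih (by omega) (by omega),
      arcAction_sigmaSeq (by omega), arcPerm_self]

theorem arcBraid_injOn {n : ℕ} {p q : ℕ × ArtinB n} (hp : p.1 ≤ n) (hq : q.1 ≤ n)
    (h : arcBraid n p = arcBraid n q) : p = q := by
  rw [← arcAction_arcBraid hp, h, arcAction_arcBraid hq]

theorem eta_injective {n : ℕ} : Function.Injective (eta n) := fun x y h => by
  have h1 : arcBraid n (0, x) = arcBraid n (0, y) := by simp [arcBraid, h]
  exact congrArg Prod.snd (arcBraid_injOn (Nat.zero_le n) (Nat.zero_le n) h1)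

/-- The pair `(i, b)` that represents the braid `g`. -/
def arcCoord (n : ℕ) (g : ArtinA n) : ℕ × ArtinB n := arcAction n g (0, 1)

theorem arcCoord_fst_le {n : ℕ} (g : ArtinA n) : (arcCoord n g).1 ≤ n :=
  (arcAction_spec g (0, 1)).1.2 (Nat.zero_le n)

theorem arcBraid_arcCoord {n : ℕ} (g : ArtinA n) : arcBraid n (arcCoord n g) = g := by
  rw [arcCoord, (arcAction_spec g (0, 1)).2 (Nat.zero_le n)]
  simp [arcBraid, descProd]

/-- The retraction `ψ` of the braid group onto `ArtinB n`. -/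
def etaRetraction (n : ℕ) (y : ArtinA n) : ArtinB n := (arcCoord n y⁻¹).2⁻¹

/-- Inverting `y⁻¹ = a_i η(b)` gives `y a_i = η(b⁻¹)`; this accounts for both inverses in the
definition of the retraction. -/
theorem eta_etaRetraction {n : ℕ} (y : ArtinA n) :
    eta n (etaRetraction n y) = y * braidArc n (arcCoord n y⁻¹).1 := by
  have h := arcBraid_arcCoord y⁻¹
  rw [braidArc_eq_descProd (arcCoord_fst_le _), etaRetraction, map_inv, inv_eq_iff_eq_inv,
    mul_inv_rev, eq_inv_mul_iff_mul_eq]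
  exact h

theorem eq_of_mem_range {n : ℕ} {y : ArtinA n} {i k : ℕ} (hi : i ≤ n) (hk : k ≤ n)
    (h : y * braidArc n i ∈ (eta n).range) (h' : y * braidArc n k ∈ (eta n).range) : i = k := by
  obtain ⟨x, hx⟩ := h
  obtain ⟨x', hx'⟩ := h'
  rw [braidArc_eq_descProd hi] at hx
  rw [braidArc_eq_descProd hk] at hx'
  have h1 : arcBraid n (i, x⁻¹) = arcBraid n (k, x'⁻¹) := by
    rw [arcBraid, arcBraid, map_inv, map_inv, hx, hx']; group
  exact congrArg Prod.fst (arcBraid_injOn hi hk h1)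

/-- If `s⁻¹ a_i = a_k η(c)`, multiplication by `s` on the right changes the value of the
retraction by `c⁻¹`. -/
theorem etaRetraction_mul {n : ℕ} (y s : ArtinA n) :
    (etaRetraction n y)⁻¹ * etaRetraction n (y * s) =
      (arcAction n s⁻¹ ((arcCoord n y⁻¹).1, 1)).2⁻¹ := by
  set p := arcCoord n y⁻¹ with hp
  set q := arcAction n s⁻¹ (p.1, 1) with hq
  have hp1 : p.1 ≤ n := arcCoord_fst_le _
  have hq1 : q.1 ≤ n := (arcAction_spec s⁻¹ (p.1, 1)).1.2 hp1
  have h1 : arcBraid n q = s⁻¹ * arcBraid n (p.1, 1) := (arcAction_spec s⁻¹ (p.1, 1)).2 hp1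
  have h2 : arcBraid n (arcCoord n (y * s)⁻¹) = arcBraid n (q.1, q.2 * p.2) := by
    rw [arcBraid_arcCoord, mul_inv_rev, ← arcBraid_arcCoord y⁻¹, ← hp]
    simp only [arcBraid, map_mul, map_one, mul_one] at h1 ⊢
    rw [← mul_assoc, ← h1, mul_assoc]
  have h3 := arcBraid_injOn (q := (q.1, q.2 * p.2)) (arcCoord_fst_le _) hq1 h2
  rw [etaRetraction, etaRetraction, h3, ← hp]
  simp
/-! ### Word norms -/

section WordNorm

variable {G H : Type*} [Group G] [Group H]

theorem wordNorm_le {P : Set G} (l : List G) (h : ∀ x ∈ l, x ∈ P ∨ x⁻¹ ∈ P) :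
    wordNorm P l.prod ≤ l.length :=
  Nat.sInf_le ⟨l, rfl, h, rfl⟩

/-- Generation is essential: the infimum of the empty set is `0`, and would not be attained by any
word. -/
theorem exists_list_wordNorm {P : Set G} (hP : Subgroup.closure P = ⊤) (g : G) :
    ∃ l : List G, l.length = wordNorm P g ∧ (∀ x ∈ l, x ∈ P ∨ x⁻¹ ∈ P) ∧ l.prod = g := by
  have hg : g ∈ (Subgroup.closure P).toSubmonoid := by rw [hP]; trivial
  rw [Subgroup.closure_toSubmonoid] at hg
  obtain ⟨l, hl, hg⟩ := Submonoid.exists_list_of_mem_closure hg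
  exact Nat.sInf_mem (s := {k | ∃ l : List G, l.length = k ∧ (∀ x ∈ l, x ∈ P ∨ x⁻¹ ∈ P) ∧
    l.prod = g}) ⟨l.length, l, rfl, hl, hg⟩

theorem wordNorm_mul_le {P : Set G} (hP : Subgroup.closure P = ⊤) (g h : G) :
    wordNorm P (g * h) ≤ wordNorm P g + wordNorm P h := by
  obtain ⟨l, hl, hlP, rfl⟩ := exists_list_wordNorm hP g
  obtain ⟨m, hm, hmP, rfl⟩ := exists_list_wordNorm hP h
  rw [← hl, ← hm, ← List.prod_append, ← List.length_append]
  exact wordNorm_le _ fun x hx => (List.mem_append.1 hx).elim (hlP x) (hmP x)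

theorem wordNorm_one (P : Set G) : wordNorm P 1 = 0 :=
  Nat.le_zero.1 (wordNorm_le [] (by simp))

theorem wordNorm_le_one {P : Set G} {g : G} (h : g ∈ P ∨ g⁻¹ ∈ P) : wordNorm P g ≤ 1 := by
  simpa using wordNorm_le (P := P) [g] (by simpa using h)

/-- A map that moves each point by a bounded amount along each generator is Lipschitz. -/
theorem wordDist_le_mul {P : Set G} {Q : Set H} (hP : Subgroup.closure P = ⊤)
    (hQ : Subgroup.closure Q = ⊤) (f : G → H) (L : ℕ)
    (h : ∀ y s, (s ∈ P ∨ s⁻¹ ∈ P) → wordNorm Q ((f y)⁻¹ * f (y * s)) ≤ L) (y y' : G) :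
    wordDist Q (f y) (f y') ≤ L * wordDist P y y' := by
  have key : ∀ (l : List G), (∀ x ∈ l, x ∈ P ∨ x⁻¹ ∈ P) → ∀ y,
      wordNorm Q ((f y)⁻¹ * f (y * l.prod)) ≤ L * l.length := by
    intro l
    induction l with
    | nil => intro _ y; simp [wordNorm_one]
    | cons s l ih =>
      intro hl y
      have h1 := h y s (hl s (by simp))
      have h2 := ih (fun x hx => hl x (by simp [hx])) (y * s)
      have h3 := wordNorm_mul_le hQ ((f y)⁻¹ * f (y * s)) ((f (y * s))⁻¹ * f (y * s * l.prod))
      rw [mul_assoc, mul_inv_cancel_left] at h3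
      rw [List.prod_cons, ← mul_assoc, List.length_cons, mul_add_one]
      omega
  obtain ⟨l, hl, hlP, hprod⟩ := exists_list_wordNorm hP (y⁻¹ * y')
  have h1 := key l hlP y
  rw [hprod, mul_inv_cancel_left, hl] at h1
  rw [wordDist, wordDist]
  exact_mod_cast h1

end WordNorm

/-! ### Parabolic subgroups -/

namespace CoxeterMatrix

variable {S : Type*} (M : CoxeterMatrix S)

theorem inv_mem_parabolicGenSet {Δ g : M.ArtinGroup} (h : g ∈ M.parabolicGenSet Δ) :
    g⁻¹ ∈ M.parabolicGenSet Δ := by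
  rcases h with ⟨X, hX, hg⟩ | h
  · exact Or.inl ⟨X, hX, inv_mem hg⟩
  · exact Or.inr (inv_mem h)

theorem mem_parabolicGenSet_of_or {Δ g : M.ArtinGroup}
    (h : g ∈ M.parabolicGenSet Δ ∨ g⁻¹ ∈ M.parabolicGenSet Δ) : g ∈ M.parabolicGenSet Δ :=
  h.elim id fun h => inv_inv g ▸ M.inv_mem_parabolicGenSet h

theorem artinGen_mem_standardParabolic {X : Set S} {s : S} (h : s ∈ X) :
    M.artinGen s ∈ M.standardParabolic X :=
  Subgroup.subset_closure ⟨s, h, rfl⟩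

theorem standardParabolic_mono {X Y : Set S} (h : X ⊆ Y) :
    M.standardParabolic X ≤ M.standardParabolic Y :=
  Subgroup.closure_mono (Set.image_mono h)

theorem mem_parabolicGenSet {Δ g : M.ArtinGroup} {X : Set S} (hX : M.IsProperIrreducible X)
    (hg : g ∈ M.standardParabolic X) : g ∈ M.parabolicGenSet Δ :=
  Or.inl ⟨X, hX, hg⟩

theorem closure_parabolicGenSet (Δ : M.ArtinGroup) (h : ∀ s, M.IsProperIrreducible {s}) :
    Subgroup.closure (M.parabolicGenSet Δ) = ⊤ := by
  refine eq_top_iff.2 fun g _ => PresentedGroup.generated_by _ _ (fun s => ?_) g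
  exact Subgroup.subset_closure
    (M.mem_parabolicGenSet (h s) (M.artinGen_mem_standardParabolic (Set.mem_singleton s)))

end CoxeterMatrix

/-- The generators with index in the interval `[p, q)`. -/
def finInterval (n p q : ℕ) : Set (Fin n) := {i | p ≤ i ∧ (i : ℕ) < q}

theorem connected_induce_finInterval {n p q : ℕ} {G : SimpleGraph (Fin n)}
    (hG : ∀ i j : Fin n, (i : ℕ) + 1 = j → G.Adj i j) (h : p < q) (hq : q ≤ n) :
    (G.induce (finInterval n p q)).Connected := by
  have hp : (⟨p, by omega⟩ : Fin n) ∈ finInterval n p q := ⟨le_rfl, h⟩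
  rw [SimpleGraph.connected_iff_exists_forall_reachable]
  refine ⟨⟨_, hp⟩, ?_⟩
  rintro ⟨⟨i, hi⟩, hpi, hiq⟩
  simp only at hpi hiq
  induction i, hpi using Nat.le_induction with
  | base => exact SimpleGraph.Reachable.refl _
  | succ i hpi ih =>
    refine (ih (by omega) (by omega)).trans (SimpleGraph.Adj.reachable ?_)
    exact hG ⟨i, by omega⟩ ⟨i + 1, hi⟩ rfl

/-- Given `q ≤ n`, the condition `q < p + n` excludes only the full interval `[0, n)`. -/
theorem isProperIrreducible_finInterval {n p q : ℕ} {M : CoxeterMatrix (Fin n)}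
    (hM : ∀ i j : Fin n, (i : ℕ) + 1 = j → M.coxeterGraph.Adj i j) (h : p < q) (hq : q ≤ n)
    (hpq : q < p + n) : M.IsProperIrreducible (finInterval n p q) := by
  refine ⟨⟨⟨p, by omega⟩, le_rfl, h⟩, fun he => ?_, connected_induce_finInterval hM h hq⟩
  have h0 : (⟨0, by omega⟩ : Fin n) ∈ finInterval n p q := he ▸ Set.mem_univ _
  have h1 : (⟨n - 1, by omega⟩ : Fin n) ∈ finInterval n p q := he ▸ Set.mem_univ _
  have h2 : p ≤ 0 := h0.1
  have h3 : n - 1 < q := h1.2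
  omega

theorem isProperIrreducible_singleton {n : ℕ} {M : CoxeterMatrix (Fin n)} (hn : 2 ≤ n)
    (hM : ∀ i j : Fin n, (i : ℕ) + 1 = j → M.coxeterGraph.Adj i j) (i : Fin n) :
    M.IsProperIrreducible {i} := by
  have h : ({i} : Set (Fin n)) = finInterval n i (i + 1) := by
    ext j
    simp only [finInterval, Set.mem_singleton_iff, Set.mem_ofPred_eq, Fin.ext_iff]
    omega
  rw [h]
  exact isProperIrreducible_finInterval hM (Nat.lt_succ_self _) i.2 (by omega)

theorem coxeterGraph_A_adj {n : ℕ} {i j : Fin n} :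
    (CoxeterMatrix.A n).coxeterGraph.Adj i j ↔ (i : ℕ) + 1 = j ∨ (j : ℕ) + 1 = i := by
  by_cases hij : i = j
  · subst hij; simp
  · have hM : CoxeterMatrix.A n i j = if (j : ℕ) + 1 = i ∨ (i : ℕ) + 1 = j then 3 else 2 := by
      simp [CoxeterMatrix.A, hij]
    simp only [CoxeterMatrix.coxeterGraph, hM]
    split_ifs with h
    · simp [hij, h.symm]
    · simpa [hij, or_comm] using h

theorem coxeterGraph_B_adj {n : ℕ} {i j : Fin n} :
    (coxeterB n).coxeterGraph.Adj i j ↔ (i : ℕ) + 1 = j ∨ (j : ℕ) + 1 = i := by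
  simp only [CoxeterMatrix.coxeterGraph, coxeterB_apply, Fin.ext_iff]
  split_ifs <;> omega

theorem coxeterGraph_B_eq_A (n : ℕ) :
    (coxeterB n).coxeterGraph = (CoxeterMatrix.A n).coxeterGraph := by
  ext i j
  rw [coxeterGraph_A_adj, coxeterGraph_B_adj]

/-- A proper connected set of vertices of the Coxeter graph of type `A_n` misses one of the ends. -/
theorem subset_finInterval_of_isProperIrreducible {n : ℕ} {X : Set (Fin n)}
    (hX : (CoxeterMatrix.A n).IsProperIrreducible X) :
    X ⊆ finInterval n 0 (n - 1) ∨ X ⊆ finInterval n 1 n := by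
  obtain ⟨-, hne, hconn⟩ := hX
  by_contra hcon
  rw [not_or, Set.not_subset, Set.not_subset] at hcon
  obtain ⟨⟨b, hb, hb'⟩, ⟨a, ha, ha'⟩⟩ := hcon
  obtain ⟨k, hk⟩ := (Set.ne_univ_iff_exists_notMem X).1 hne
  -- Edges change the index by one, so a walk inside `X` cannot jump over the missing vertex `k`;
  -- but `a` and `b` are the two ends of the graph.
  have key : ∀ u v : X, ((CoxeterMatrix.A n).coxeterGraph.induce X).Walk u v →
      (u : Fin n) < k → (v : Fin n) < k := by
    intro u v w
    induction w with
    | nil => exact id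
    | @cons u v w huv _ ih =>
      refine fun hu => ih ?_
      have h1 := coxeterGraph_A_adj.1 (SimpleGraph.comap_adj.1 huv)
      have h2 : (v : Fin n) ≠ k := fun e => hk (e ▸ v.2)
      rw [Fin.lt_def] at hu ⊢
      rw [Ne, Fin.ext_iff] at h2
      simp only [Function.Embedding.subtype_apply] at h1
      omega
  have hak : a ≠ k := fun e => hk (e ▸ ha)
  have hbk : b ≠ k := fun e => hk (e ▸ hb)
  obtain ⟨w⟩ := hconn.preconnected ⟨a, ha⟩ ⟨b, hb⟩
  have h := key _ _ w
  simp only [finInterval, Set.mem_ofPred_eq, Fin.lt_def, Ne, Fin.ext_iff] at *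
  omega

/-! ### The generating sets and their images under `η` -/

theorem closure_genSetA {n : ℕ} (hn : 2 ≤ n) : Subgroup.closure (genSetA n) = ⊤ :=
  CoxeterMatrix.closure_parabolicGenSet _ _ fun i =>
    isProperIrreducible_singleton hn (fun _ _ h => coxeterGraph_A_adj.2 (Or.inl h)) i

theorem closure_genSetB {n : ℕ} (hn : 2 ≤ n) : Subgroup.closure (genSetB n) = ⊤ :=
  CoxeterMatrix.closure_parabolicGenSet _ _ fun i =>
    isProperIrreducible_singleton hn (fun _ _ h => coxeterGraph_B_adj.2 (Or.inl h)) i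

/-- The standard parabolic subgroup of `ArtinB n` generated by the generators with index in
`[p, q)`. -/
def tauParabolic (n p q : ℕ) : Subgroup (ArtinB n) :=
  (coxeterB n).standardParabolic (finInterval n p q)

theorem tauSeq_mem_tauParabolic {n p q j : ℕ} (h : p ≤ j) (hq : j < q) :
    tauSeq n j ∈ tauParabolic n p q := by
  unfold tauSeq
  split_ifs with hj
  · exact (coxeterB n).artinGen_mem_standardParabolic ⟨h, hq⟩
  · exact one_mem _

theorem tauLoop_mem_tauParabolic {n q j : ℕ} (hq : j < q) :
    tauLoop n j ∈ tauParabolic n 0 q := by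
  induction j with
  | zero => exact tauSeq_mem_tauParabolic le_rfl hq
  | succ j ih =>
    have h := tauSeq_mem_tauParabolic (n := n) (Nat.zero_le _) hq
    exact mul_mem (mul_mem h (ih (by omega))) (inv_mem h)

theorem tauParabolic_subset_genSetB {n p q : ℕ} (h : p < q) (hq : q ≤ n) (hpq : q < p + n)
    {b : ArtinB n} (hb : b ∈ tauParabolic n p q) : b ∈ genSetB n :=
  CoxeterMatrix.mem_parabolicGenSet _
    (isProperIrreducible_finInterval (fun _ _ h => coxeterGraph_B_adj.2 (Or.inl h)) h hq hpq) hb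

theorem eta_mem_genSetA {n : ℕ} {b : ArtinB n} (hb : b ∈ genSetB n) : eta n b ∈ genSetA n := by
  rcases hb with ⟨X, ⟨h1, h2, h3⟩, hb⟩ | ⟨m, rfl⟩
  · refine CoxeterMatrix.mem_parabolicGenSet _ ⟨h1, h2, coxeterGraph_B_eq_A n ▸ h3⟩ ?_
    have hle : (coxeterB n).standardParabolic X ≤
        ((CoxeterMatrix.A n).standardParabolic X).comap (eta n) := by
      refine (Subgroup.closure_le _).2 ?_
      rintro _ ⟨i, hi, rfl⟩
      have hs : sigma n i ∈ (CoxeterMatrix.A n).standardParabolic X :=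
        CoxeterMatrix.artinGen_mem_standardParabolic _ hi
      have he : eta n ((coxeterB n).artinGen i) = _ := eta_tau n i
      rw [SetLike.mem_coe, Subgroup.mem_comap, he]
      split_ifs
      · exact pow_mem hs 2
      · exact hs
    exact hle hb
  -- The exponent doubles because `η(Δ_B ^ 2) = Δ_A ^ 4`.
  · refine Or.inr ⟨2 * m, ?_⟩
    simp only [map_zpow, map_pow, eta_garsideB, zpow_mul, zpow_ofNat]

/-- For `i < n` the braid `a_i` avoids `σ_n` and is a single letter of `𝒫`; only `a_n = σ_n a_{n-1}`
needs a second one. -/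
theorem wordNorm_descProd_inv_le {n : ℕ} (hn : 2 ≤ n) {i : ℕ} (hi : i ≤ n) :
    wordNorm (genSetA n) (descProd (sigmaSeq n) i)⁻¹ ≤ 2 := by
  have hcl := closure_genSetA hn
  have hmem : ∀ k < n, (descProd (sigmaSeq n) k)⁻¹ ∈ genSetA n := by
    intro k hk
    refine CoxeterMatrix.mem_parabolicGenSet _ (isProperIrreducible_finInterval (p := 0)
      (q := n - 1) (fun _ _ h => coxeterGraph_A_adj.2 (Or.inl h)) (by omega) (by omega)
      (by omega)) (inv_mem (descProd_mem fun j hj => ?_))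
    rw [sigmaSeq, dif_pos (by omega)]
    exact CoxeterMatrix.artinGen_mem_standardParabolic _ ⟨Nat.zero_le _, by simp; omega⟩
  rcases hi.lt_or_eq with h | rfl
  · exact (wordNorm_le_one (Or.inl (hmem i h))).trans one_le_two
  · obtain ⟨k, rfl⟩ : ∃ k, i = k + 1 := ⟨i - 1, by omega⟩
    rw [descProd, mul_inv_rev]
    refine (wordNorm_mul_le hcl _ _).trans (add_le_add (wordNorm_le_one (Or.inl (hmem k
      (by omega)))) (wordNorm_le_one (Or.inr ?_)))
    rw [inv_inv, sigmaSeq, dif_pos (by omega)]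
    exact CoxeterMatrix.mem_parabolicGenSet _ (isProperIrreducible_singleton hn
      (fun _ _ h => coxeterGraph_A_adj.2 (Or.inl h)) _)
      (CoxeterMatrix.artinGen_mem_standardParabolic _ rfl)

/-! ### The cocycle on parabolic subgroups -/

/-- The set `I × T` is invariant under the generators in `X`, hence under the subgroup they
generate. Applied to `(i, 1)`, this confines the cocycle to `T`. The equivalence, rather than an
implication, is what passes to inverses. -/
theorem arcAction_mem_iff {n : ℕ} {X : Set (Fin n)} {I : Set ℕ} {T : Subgroup (ArtinB n)}
    (hI : ∀ j : Fin n, j ∈ X → ∀ i, Equiv.swap (j : ℕ) (j + 1) i ∈ I ↔ i ∈ I)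
    (hT : ∀ j : Fin n, j ∈ X → ∀ i ∈ I, arcCocycle n j i ∈ T) {s : ArtinA n}
    (hs : s ∈ (CoxeterMatrix.A n).standardParabolic X) (p : ℕ × ArtinB n) :
    ((arcAction n s p).1 ∈ I ∧ (arcAction n s p).2 ∈ T) ↔ (p.1 ∈ I ∧ p.2 ∈ T) := by
  induction hs using Subgroup.closure_induction generalizing p with
  | mem x hx =>
    obtain ⟨j, hj, rfl⟩ := hx
    have h1 : arcAction n ((CoxeterMatrix.A n).artinGen j) = arcPerm n j :=
      PresentedGroup.toGroup.of _
    obtain ⟨i, b⟩ := p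
    rw [h1, arcPerm_apply]
    refine (and_congr_left fun _ => hI j hj i).trans (and_congr_right fun hi => ?_)
    exact T.mul_mem_cancel_left (hT j hj i hi)
  | one => simp
  | mul x y _ _ hx hy => rw [map_mul, Equiv.Perm.mul_apply, hx, hy]
  | inv x _ hx =>
    rw [← hx, ← Equiv.Perm.mul_apply, ← map_mul, mul_inv_cancel, map_one, Equiv.Perm.one_apply]

theorem swap_succ_mem_iff {j : ℕ} {I : Set ℕ} (h : j ∈ I ↔ j + 1 ∈ I) (i : ℕ) :
    Equiv.swap j (j + 1) i ∈ I ↔ i ∈ I := by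
  rw [Equiv.swap_apply_def]
  split_ifs with h1 h2
  · rw [h1, h]
  · rw [h2, h]
  · rfl

/-- The braid `τ_1 ⋯ τ_{n - 1}`, which conjugates `τ_j` to `τ_{j + 1}` for `1 ≤ j < n - 1`. -/
def tauShift (n : ℕ) : ArtinB n := ascProd (fun i => tauSeq n (i + 1)) (n - 1)

theorem tauShift_mem (n : ℕ) : tauShift n ∈ tauParabolic n 1 n :=
  ascProd_mem fun i hi => tauSeq_mem_tauParabolic (by omega) (by omega)

/-- The conjugate of the parabolic subgroup of type `B_{n - 1}` by `tauShift n`. -/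
def shiftedParabolic (n : ℕ) : Subgroup (ArtinB n) :=
  (tauParabolic n 0 (n - 1)).map (MulAut.conj (tauShift n)).toMonoidHom

theorem tauSeq_mem_shiftedParabolic {n j : ℕ} (h : 2 ≤ j) (hj : j < n) :
    tauSeq n j ∈ shiftedParabolic n := by
  obtain ⟨k, rfl⟩ : ∃ k, j = k + 1 + 1 := ⟨j - 2, by omega⟩
  refine ⟨tauSeq n (k + 1), tauSeq_mem_tauParabolic (Nat.zero_le _) (by omega), ?_⟩
  have h1 : tauShift n * tauSeq n (k + 1) = tauSeq n (k + 1 + 1) * tauShift n :=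
    (isBraidSeq_tauSeq_succ n).ascProd_mul le_rfl (show k + 1 < n - 1 by omega)
  show tauShift n * tauSeq n (k + 1) * (tauShift n)⁻¹ = _
  rw [h1, mul_inv_cancel_right]

/-- Since `tauSeq n 0` commutes with every factor of `tauShift n` but the first, its conjugate by
`tauShift n` is `tauLoop n 1`. The later loops are conjugates of this one by elements already in the
subgroup. -/
theorem tauLoop_mem_shiftedParabolic {n j : ℕ} (h : 1 ≤ j) (hj : j < n) :
    tauLoop n j ∈ shiftedParabolic n := by
  induction j, h using Nat.le_induction with
  | base =>
    refine ⟨tauSeq n 0, tauSeq_mem_tauParabolic le_rfl (by omega), ?_⟩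
    have key : ∀ k, 1 ≤ k → ascProd (fun i => tauSeq n (i + 1)) k * tauSeq n 0 =
        tauLoop n 1 * ascProd (fun i => tauSeq n (i + 1)) k := by
      intro k hk
      induction k, hk using Nat.le_induction with
      | base => simp [ascProd, tauLoop]
      | succ k hk ih =>
        rw [ascProd, mul_assoc, ← (tauSeq_comm n (show 0 + 1 < k + 1 by omega)).eq, ← mul_assoc,
          ih, mul_assoc]
    show tauShift n * tauSeq n 0 * (tauShift n)⁻¹ = _
    rw [tauShift, key _ (by omega), mul_inv_cancel_right]
  | succ j h ih =>
    have h1 := tauSeq_mem_shiftedParabolic (show 2 ≤ j + 1 by omega) hj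
    exact mul_mem (mul_mem h1 (ih (by omega))) (inv_mem h1)

theorem wordNorm_le_of_mem_shiftedParabolic {n : ℕ} (hn : 2 ≤ n) {b : ArtinB n}
    (hb : b ∈ shiftedParabolic n) : wordNorm (genSetB n) b ≤ 3 := by
  obtain ⟨c, hc, rfl⟩ := hb
  have h1 := tauParabolic_subset_genSetB (by omega) le_rfl (by omega) (tauShift_mem n)
  have h2 := tauParabolic_subset_genSetB (by omega) (by omega) (by omega) hc
  have h3 := wordNorm_le (P := genSetB n) [tauShift n, c, (tauShift n)⁻¹] (by simp [h1, h2])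
  simpa [mul_assoc] using h3

/-- The set `X` misses the last or the first vertex, and in each case the coset index that is fixed
is treated apart. Three of the four cases give a parabolic subgroup, of norm at most 1; only the
last needs a conjugate. -/
theorem wordNorm_arcAction_le_of_mem_standardParabolic {n : ℕ} (hn : 2 ≤ n) {X : Set (Fin n)}
    (hX : (CoxeterMatrix.A n).IsProperIrreducible X) {s : ArtinA n}
    (hs : s ∈ (CoxeterMatrix.A n).standardParabolic X) {i : ℕ} (hi : i ≤ n) :
    wordNorm (genSetB n) (arcAction n s (i, 1)).2⁻¹ ≤ 3 := by
  have key : ∀ (Y : Set (Fin n)) (I : Set ℕ) (T : Subgroup (ArtinB n)), X ⊆ Y →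
      (∀ j : Fin n, j ∈ Y → ((j : ℕ) ∈ I ↔ (j : ℕ) + 1 ∈ I)) →
      (∀ j : Fin n, j ∈ Y → ∀ i ∈ I, arcCocycle n j i ∈ T) →
      (∀ b ∈ T, wordNorm (genSetB n) b ≤ 3) → i ∈ I →
      wordNorm (genSetB n) (arcAction n s (i, 1)).2⁻¹ ≤ 3 := by
    intro Y I T hXY hI hT hN hiI
    refine hN _ (inv_mem ((arcAction_mem_iff (fun j hj => swap_succ_mem_iff (hI j hj)) hT
      (CoxeterMatrix.standardParabolic_mono _ hXY hs) _).2 ⟨hiI, one_mem T⟩).2)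
  have hN : ∀ p q, p < q → q ≤ n → q < p + n → ∀ b ∈ tauParabolic n p q,
      wordNorm (genSetB n) b ≤ 3 := fun p q h1 h2 h3 b hb =>
    (wordNorm_le_one (Or.inl (tauParabolic_subset_genSetB h1 h2 h3 hb))).trans (by norm_num)
  rcases subset_finInterval_of_isProperIrreducible hX with h | h
  · rcases hi.lt_or_eq with hin | rfl
    · refine key _ (Set.Iio n) (tauParabolic n 0 (n - 1)) h ?_ ?_
        (hN _ _ (by omega) (by omega) (by omega)) hin
      · rintro j ⟨-, hj⟩
        simp only [Set.mem_Iio]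
        omega
      · rintro j ⟨-, hj⟩ k (hk : k < n)
        unfold arcCocycle
        split_ifs
        · exact tauSeq_mem_tauParabolic (Nat.zero_le _) hj
        · exact one_mem _
        · exact tauLoop_mem_tauParabolic hj
        · exact tauSeq_mem_tauParabolic (Nat.zero_le _) (by omega)
        · exact one_mem _
    -- The index `n` is fixed, and each `σ_j` acts over it as the next generator, so the values
    -- generate a subgroup of type `A`.
    · refine key _ {i} (tauParabolic i 1 i) h ?_ ?_
        (hN _ _ (by omega) (by omega) (by omega)) rfl
      · rintro j ⟨-, hj⟩
        simp only [Set.mem_singleton_iff]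
        omega
      · rintro j ⟨-, hj⟩ k rfl
        rw [arcCocycle_of_gt (by omega) le_rfl]
        exact tauSeq_mem_tauParabolic (by omega) (by omega)
  · rcases Nat.eq_zero_or_pos i with rfl | hi0
    · refine key _ {0} (tauParabolic n 1 n) h ?_ ?_
        (hN _ _ (by omega) (by omega) (by omega)) rfl
      · rintro j ⟨hj, -⟩
        simp only [Set.mem_singleton_iff]
        omega
      · rintro j ⟨hj, -⟩ k rfl
        rw [arcCocycle_of_lt (by omega)]
        exact tauSeq_mem_tauParabolic hj j.2
    -- Over the indices `1, …, n` only loops of positive index and generators `tauSeq n j` with `j ≥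
    -- 2` occur.
    · refine key _ (Set.Icc 1 n) (shiftedParabolic n) h ?_ ?_
        (fun b => wordNorm_le_of_mem_shiftedParabolic hn) ⟨hi0, hi⟩
      · rintro j ⟨hj, -⟩
        have := j.2
        simp only [Set.mem_Icc]
        omega
      · rintro j ⟨hj, -⟩ k ⟨hk, hk'⟩
        unfold arcCocycle
        split_ifs
        · exact tauSeq_mem_shiftedParabolic (by omega) j.2
        · exact one_mem _
        · exact tauLoop_mem_shiftedParabolic hj j.2
        · exact tauSeq_mem_shiftedParabolic (by omega) (by omega)

/-- Centrality moves `Δ_A ^ (2m) = η(Δ_B ^ m)` across `a_i`, and uniqueness of coordinates reads off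
the pair. -/
theorem arcAction_garsideA_zpow {n i : ℕ} (hi : i ≤ n) (m : ℤ) :
    arcAction n ((garsideA n ^ 2) ^ m) (i, 1) = (i, garsideB n ^ m) := by
  have h := arcAction_spec ((garsideA n ^ 2) ^ m) (i, (1 : ArtinB n))
  refine arcBraid_injOn (h.1.2 hi) hi ((h.2 hi).trans ?_)
  have hc : Commute (descProd (sigmaSeq n) i) ((garsideA n ^ 2) ^ m) :=
    (commute_garsideA_sq n _).zpow_right m
  simp only [arcBraid, map_one, mul_one, map_zpow, eta_garsideB, hc.eq]

/-- The cyclic part of `𝒫` contains the even powers of `Δ_B`; an odd power costs one further factor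
`Δ_B`. -/
theorem wordNorm_garsideB_zpow_le {n : ℕ} (hn : 2 ≤ n) (m : ℤ) :
    wordNorm (genSetB n) (garsideB n ^ m) ≤ 1 + wordNorm (genSetB n) (garsideB n) := by
  have h1 : ∀ k : ℤ, wordNorm (genSetB n) ((garsideB n ^ 2) ^ k) ≤ 1 := fun k =>
    wordNorm_le_one (Or.inl (Or.inr ⟨k, rfl⟩))
  obtain ⟨k, rfl | rfl⟩ := Int.even_or_odd' m
  · rw [zpow_mul]
    exact (h1 k).trans (Nat.le_add_right _ _)
  · rw [zpow_add_one, zpow_mul]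
    exact (wordNorm_mul_le (closure_genSetB hn) _ _).trans (Nat.add_le_add_right (h1 k) _)

/-! ### Lipschitz estimates and the quasi-isometry -/

theorem wordNorm_etaRetraction_mul_le {n : ℕ} (hn : 2 ≤ n) (y : ArtinA n) {s : ArtinA n}
    (hs : s ∈ genSetA n) :
    wordNorm (genSetB n) ((etaRetraction n y)⁻¹ * etaRetraction n (y * s)) ≤
      3 + wordNorm (genSetB n) (garsideB n) := by
  rw [etaRetraction_mul]
  have hi : (arcCoord n y⁻¹).1 ≤ n := arcCoord_fst_le _
  rcases hs with ⟨X, hX, hs⟩ | ⟨m, rfl⟩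
  · exact (wordNorm_arcAction_le_of_mem_standardParabolic hn hX (inv_mem hs) hi).trans
      (Nat.le_add_right _ _)
  · simp only [← zpow_neg]
    rw [arcAction_garsideA_zpow hi, ← zpow_neg]
    exact (wordNorm_garsideB_zpow_le hn _).trans (by omega)

theorem etaRetraction_eta {n : ℕ} (x : ArtinB n) : etaRetraction n (eta n x) = x := by
  rw [etaRetraction, arcCoord, ← map_inv, arcAction_eta]
  simp

theorem wordDist_eta_le {n : ℕ} (hn : 2 ≤ n) (x x' : ArtinB n) :
    wordDist (genSetA n) (eta n x) (eta n x') ≤ wordDist (genSetB n) x x' := by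
  have h := wordDist_le_mul (closure_genSetB hn) (closure_genSetA hn) (eta n) 1
    (fun y s hs => ?_) x x'
  · simpa using h
  · rw [map_mul, inv_mul_cancel_left]
    exact wordNorm_le_one (Or.inl (eta_mem_genSetA (CoxeterMatrix.mem_parabolicGenSet_of_or _ hs)))

theorem wordDist_etaRetraction_le {n : ℕ} (hn : 2 ≤ n) (y y' : ArtinA n) :
    wordDist (genSetB n) (etaRetraction n y) (etaRetraction n y') ≤
      (3 + wordNorm (genSetB n) (garsideB n) : ℕ) * wordDist (genSetA n) y y' :=
  wordDist_le_mul (closure_genSetA hn) (closure_genSetB hn) _ _ (fun y _ hs =>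
    wordNorm_etaRetraction_mul_le hn y (CoxeterMatrix.mem_parabolicGenSet_of_or _ hs)) y y'

theorem wordDist_eta_etaRetraction_le {n : ℕ} (hn : 2 ≤ n) (y : ArtinA n) :
    wordDist (genSetA n) (eta n (etaRetraction n y)) y ≤ 2 := by
  have hi : (arcCoord n y⁻¹).1 ≤ n := arcCoord_fst_le _
  rw [wordDist, eta_etaRetraction, braidArc_eq_descProd hi, mul_inv_rev, inv_mul_cancel_right]
  exact_mod_cast wordNorm_descProd_inv_le hn hi

theorem isQuasiIsometry_eta {n : ℕ} (hn : 2 ≤ n) :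
    IsQuasiIsometry (wordDist (genSetB n)) (wordDist (genSetA n)) (eta n) := by
  set L : ℕ := 3 + wordNorm (genSetB n) (garsideB n) with hL
  have hL1 : (1 : ℝ) ≤ L := by exact_mod_cast (show 1 ≤ L by omega)
  refine ⟨L, 2, hL1, by norm_num, fun x x' => ⟨?_, ?_⟩,
    fun y => ⟨etaRetraction n y, wordDist_eta_etaRetraction_le hn y⟩⟩
  -- The lower bound is the Lipschitz bound for `ψ` applied to `η x` and `η x'`, as `ψ ∘ η = id`.
  · have h := wordDist_etaRetraction_le hn (eta n x) (eta n x')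
    rw [etaRetraction_eta, etaRetraction_eta, ← hL] at h
    have h' : (L : ℝ)⁻¹ * wordDist (genSetB n) x x' ≤ wordDist (genSetA n) (eta n x) (eta n x') :=
      (inv_mul_le_iff₀ (by linarith)).2 h
    linarith
  · have h := wordDist_eta_le hn x x'
    have h0 : 0 ≤ wordDist (genSetB n) x x' := Nat.cast_nonneg _
    nlinarith

theorem proposition3 (n : ℕ) (hn : 3 ≤ n) :
    -- the sets `𝒫` are generating sets, so that the word metrics are genuine metrics
    Subgroup.closure (genSetB n) = ⊤ ∧
    Subgroup.closure (genSetA n) = ⊤ ∧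
    -- `η` is a monomorphism and a quasi-isometry
    Function.Injective (eta n) ∧
    IsQuasiIsometry (wordDist (genSetB n)) (wordDist (genSetA n)) (eta n) ∧
    -- `η` is `1`-Lipschitz
    (∀ x x' : ArtinB n,
      wordDist (genSetA n) (eta n x) (eta n x') ≤ wordDist (genSetB n) x x') ∧
    -- `ψ(y) = η⁻¹(y a_i)`, for the unique `i` with `y a_i` in the image of `η`,
    -- is a Lipschitz quasi-inverse of `η`
    (∀ y : ArtinA n, ∃! i : Fin (n + 1), y * braidArc n i ∈ (eta n).range) ∧
    ∃ ψ : ArtinA n → ArtinB n,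
      (∀ (y : ArtinA n) (i : Fin (n + 1)), y * braidArc n i ∈ (eta n).range →
        eta n (ψ y) = y * braidArc n i) ∧
      (∀ x : ArtinB n, ψ (eta n x) = x) ∧
      (∀ y : ArtinA n, wordDist (genSetA n) (eta n (ψ y)) y ≤ 2) ∧
      ∃ L : ℝ, ∀ y y' : ArtinA n,
        wordDist (genSetB n) (ψ y) (ψ y') ≤ L * wordDist (genSetA n) y y' := by
  have hn2 : 2 ≤ n := by omega
  have hmem : ∀ y : ArtinA n, y * braidArc n (arcCoord n y⁻¹).1 ∈ (eta n).range := fun y =>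
    ⟨_, eta_etaRetraction y⟩
  refine ⟨closure_genSetB hn2, closure_genSetA hn2, eta_injective, isQuasiIsometry_eta hn2,
    wordDist_eta_le hn2, fun y => ?_, etaRetraction n, fun y i hi => ?_, etaRetraction_eta,
    wordDist_eta_etaRetraction_le hn2, _, wordDist_etaRetraction_le hn2⟩
  · refine ⟨⟨(arcCoord n y⁻¹).1, Nat.lt_succ_of_le (arcCoord_fst_le _)⟩, hmem y, fun i hi => ?_⟩
    exact Fin.ext (eq_of_mem_range (Nat.le_of_lt_succ i.2) (arcCoord_fst_le _) hi (hmem y))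
  · rw [eta_etaRetraction,
      eq_of_mem_range (arcCoord_fst_le _) (Nat.le_of_lt_succ i.2) (hmem y) hi]
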